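/- Let $X$ be a nonempty measurable space with countably generated $\sigma$-algebra (for instance $\mathbb{R}^d$), and call probability measures on $X$ distributions. For distributions $\mu,\nu$ let $d_{TV}(\mu,\nu)=\sup_E|\mu(E)-\nu(E)|$, and for a nonempty class $\mathcal F$ of distributions let $d_{TV}(g,\mathcal F)=\inf_{f\in\mathcal F}d_{TV}(g,f)$. The set of distributions carries the $\sigma$-algebra generated by the evaluations $\mu\mapsto\mu(E)$, and a (randomized) algorithm is a Markov kernel from inputs to outputs; a deterministic measurable algorithm is a special case. **Stable list decoding.** For $m,L\in\mathbb N$, $\mathcal F$ is *$(C,\alpha)$-accurate $(m,\rho,L)$-stable-list-decodable* if there is an algorithm $\mathcal A$ mapping samples $S\in X^m$ to lists of $L$ distributions such that for every distribution $g$ (not necessarily in $\mathcal F$) there is a distribution $\tilde g$ with $\Pr_{S\sim g^m}[\tilde g\in\mathcal A(S)]\ge\rho$ and $d_{TV}(\tilde g,g)<\alpha+C\, d_{TV}(g,\mathcal F)$. **Private agnostic learning.** $\mathcal F$ is *$(\varepsilon,\delta)$-privately $C$-agnostic $(n,\alpha,\beta)$-learnable* if there is an algorithm $\mathcal M$ mapping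 finite samples to distributions such that for every sample size $N\ge n$: (i) for all $D,D'\in X^N$ differing in at most one entry and every measurable set $E$ of distributions, $\Pr[\mathcal M(D)\in E]\le e^{\varepsilon}\Pr[\mathcal M(D')\in E]+\delta$; and (ii) for every distribution $g$, if $S\sim g^N$, then with probability at least $1-\beta$ (over $S$ and the randomness of $\mathcal M$), $d_{TV}(\mathcal M(S),g)\le C\, d_{TV}(g,\mathcal F)+\alpha$. **Theorem.** There are universal constants $K>0$ and $k\in\mathbb N$ such that the following holds. Let $X$ be as above, $\mathcal F$ a nonempty class of distributions on $X$, $m,L\in\mathbb N$, $C>1$, $\varepsilon>0$ and $\alpha,\beta,\delta\in(0,1)$. If $\mathcal F$ is $\left(C,\frac{\alpha}{3+4C}\right)$-accurate $(m,0.91,L)$-stable-list-decodable, then $\mathcal F$ is $(\varepsilon,\delta)$-privately $7C$-agnostic $(n,\alpha,\beta)$-learnable for some $n\in\mathbb N$ with $$n\le K\,\Phi\,\bigl(\log(2+\Phi)\bigr)^{k},\qquad \Phi=\frac{\log\bigl(L/(\delta\beta)\bigr)}{\min(\varepsilon,1)}\left(m+\frac{\log(L/\beta)}{\alpha^{2}}\right);$$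 that is, for $\varepsilon\le 1$, $n=\tilde O\left(\frac{\log(L/(\delta\beta))}{\varepsilon}\left(m+\frac{\log(L/\beta)}{\alpha^2}\right)\right)$. -/

import Mathlib

open MeasureTheory ProbabilityTheory

namespace PrivateDensity

/-- Total variation distance `sup_E |μ E - ν E|` over measurable events; for measures with densities
`f₁, f₂` with respect to a common measure this is `(1/2) ∫ |f₁ - f₂|`. The supremum is over a nonempty
family of reals bounded by `1`. -/
noncomputable def tvDist {X : Type*} [MeasurableSpace X] (μ ν : ProbabilityMeasure X) : ℝ :=
  ⨆ E : {E : Set X // MeasurableSet E},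
    |(μ : Measure X).real (E : Set X) - (ν : Measure X).real (E : Set X)|

/-- `OPT = inf_{f ∈ F} tvDist g f`, the distance from `g` to the (nonempty) class `F`. -/
noncomputable def distToClass {X : Type*} [MeasurableSpace X] (g : ProbabilityMeasure X)
    (F : Set (ProbabilityMeasure X)) : ℝ :=
  ⨅ f : F, tvDist g (f : ProbabilityMeasure X)

/-- The law of the output of the (randomized) algorithm `A` when run on `n` i.i.d. samples from `g`.
A randomized algorithm is a Markov kernel; a deterministic one is a deterministic kernel. -/
noncomputable def outputLaw {X Y : Type*} [MeasurableSpace X] [MeasurableSpace Y] {n : ℕ}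
    (A : Kernel (Fin n → X) Y) (g : ProbabilityMeasure X) : Measure Y :=
  A ∘ₘ (Measure.pi fun _ : Fin n => (g : Measure X))

/-- `A`, which maps a sample of size `m` to a list of `L` distributions, is a `(C, α)`-accurate
`(m, ρ, L)`-stable list decoder for `F`. -/
def IsStableListDecoder {X : Type*} [MeasurableSpace X] (F : Set (ProbabilityMeasure X))
    (C α : ℝ) (m : ℕ) (ρ : ℝ) (L : ℕ)
    (A : Kernel (Fin m → X) (Fin L → ProbabilityMeasure X)) : Prop :=
  IsMarkovKernel A ∧
    ∀ g : ProbabilityMeasure X, ∃ g' : ProbabilityMeasure X,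
      ENNReal.ofReal ρ ≤ outputLaw A g {H | ∃ j, H j = g'} ∧
        tvDist g' g < α + C * distToClass g F

/-- `F` is `(C, α)`-accurate `(m, ρ, L)`-stable-list-decodable. -/
def StableListDecodable {X : Type*} [MeasurableSpace X] (F : Set (ProbabilityMeasure X))
    (C α : ℝ) (m : ℕ) (ρ : ℝ) (L : ℕ) : Prop :=
  ∃ A : Kernel (Fin m → X) (Fin L → ProbabilityMeasure X), IsStableListDecoder F C α m ρ L A

/-- Two datasets of the same size are neighbouring if they differ in (at most) one entry. -/
def Neighbouring {X : Type*} {n : ℕ} (D D' : Fin n → X) : Prop :=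
  ∃ i, ∀ j, j ≠ i → D j = D' j

/-- `(ε, δ)`-indistinguishability of two measures. -/
def Indistinguishable {Y : Type*} [MeasurableSpace Y] (ε δ : ℝ) (μ ν : Measure Y) : Prop :=
  ∀ E : Set Y, MeasurableSet E →
    μ E ≤ ENNReal.ofReal (Real.exp ε) * ν E + ENNReal.ofReal δ ∧
      ν E ≤ ENNReal.ofReal (Real.exp ε) * μ E + ENNReal.ofReal δ

/-- `(ε, δ)`-differential privacy of a randomized algorithm on datasets of size `n`. -/
def DifferentiallyPrivate {X Y : Type*} [MeasurableSpace X] [MeasurableSpace Y] {n : ℕ}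
    (ε δ : ℝ) (M : Kernel (Fin n → X) Y) : Prop :=
  ∀ D D' : Fin n → X, Neighbouring D D' → Indistinguishable ε δ (M D) (M D')

/-- On i.i.d. samples of size `n` from any `g`, the output of `M` is, with probability at least
`1 - β`, within total variation distance `C * OPT + α` of `g`. -/
def AgnosticallyAccurate {X : Type*} [MeasurableSpace X] (F : Set (ProbabilityMeasure X))
    (C α β : ℝ) {n : ℕ} (M : Kernel (Fin n → X) (ProbabilityMeasure X)) : Prop :=
  ∀ g : ProbabilityMeasure X,
    ENNReal.ofReal (1 - β) ≤ outputLaw M g {f | tvDist f g ≤ C * distToClass g F + α}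

/-- `F` is `(ε, δ)`-privately `C`-agnostic `(n, α, β)`-learnable: some randomized algorithm `M` is, on
datasets of every size `N ≥ n`, both `(ε, δ)`-differentially private and agnostically accurate. -/
def PrivatelyAgnosticLearnable {X : Type*} [MeasurableSpace X] (F : Set (ProbabilityMeasure X))
    (ε δ C : ℝ) (n : ℕ) (α β : ℝ) : Prop :=
  ∃ M : (N : ℕ) → Kernel (Fin N → X) (ProbabilityMeasure X),
    ∀ N : ℕ, n ≤ N →
      IsMarkovKernel (M N) ∧ DifferentiallyPrivate ε δ (M N) ∧ AgnosticallyAccurate F C α β (M N)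

/-- The sample complexity, up to logarithmic factors. -/
noncomputable def sampleRate (ε δ α β : ℝ) (m L : ℕ) : ℝ :=
  Real.log (L / (δ * β)) / min ε 1 * (m + Real.log (L / β) / α ^ 2)

end PrivateDensity

/-!
# Stable list decoding gives private agnostic learning of distributions

The learner is one round of subsample-and-aggregate. The sample is cut into `10 τ` blocks, each with
`m` points for the list decoder and `s` points for testing. The decoder is run on every block, which
gives `10 τ` lists. By Chernoff's bound (`lintegral_pi_few_successes_le`) the stable distribution
`f₁` is in at least `8 τ` of them. A candidate `f` is tested against a competitor `f'` in a block by
comparing, on a set that nearly realises the total variation distance of `f` and `f'`, the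
empirical frequency in the block with the probability under `f`; the test at level `i` allows an
error `i η`. This is the minimum distance estimate of Yatracos, with the competitors restricted to
those that occur in many lists.

The difficulty is to have the candidate chosen by integer scores that change by at most one when one
block changes, while the distance from the source to the class, hence the right level, is unknown.
The score (`score`) asks for a level at which the candidate does well while at the previous level no
candidate does very well. All requirements are counts of blocks, so every score has sensitivity one
(`score_le_succ_of_differ_at`). As soon as some level lets a candidate do well, the first such level
gives a candidate with the full score `2 τ` (`exists_score_eq`).
Conversely, when `f₁` is in `8 τ` lists and no test sample deviates, `f₁` passes all tests from
level `Δ / η + 1` on, `Δ` being its distance from the source; so a candidate with positive score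
passes a test against `f₁` at a level less than one above that, and this puts it within `3 Δ + 4 η`
of the source (`tvDist_le_of_score_pos`).

The output is a candidate drawn with weight `exp (ε * score) - 1`, or a fallback of fixed weight
`W ≈ L / δ`. Candidates of score zero have weight zero, and at most `4 L` have positive score
(`card_score_pos_le`), so candidates that appear or disappear with a change of one block cost only
an additive `O(ε L / W)`: the selection is differentially private (`selProb_le`) although the set of
candidates depends on the data. The randomness of the list decoder is treated by resampling the list
of the changed block (`lintegral_pi_le_of_differ_at`). A full score outweighs the fallback as soon
as `exp (2 ε τ)` is large against `L / (δ β)`.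

If `L = 1` the claimed sample size can be below one. In this case the stable distribution does not
depend on the source (`stable_eq_of_singleton_lists`): it cannot change along a segment of
mixtures. Hence it can be output without any sample.
-/

namespace PrivateDensity

/-! ### Total variation distance and a countable determining algebra -/

section TotalVariation

variable {X : Type*} [MeasurableSpace X]

lemma abs_measureReal_sub_le_one (μ ν : ProbabilityMeasure X) (E : Set X) :
    |(μ : Measure X).real E - (ν : Measure X).real E| ≤ 1 := by
  rw [abs_sub_le_iff]
  constructor <;>
    linarith [measureReal_nonneg (μ := (μ : Measure X)) (s := E),
      measureReal_nonneg (μ := (ν : Measure X)) (s := E),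
      measureReal_le_one (μ := (μ : Measure X)) (s := E),
      measureReal_le_one (μ := (ν : Measure X)) (s := E)]

lemma abs_measureReal_sub_le_tvDist (μ ν : ProbabilityMeasure X) {E : Set X}
    (hE : MeasurableSet E) :
    |(μ : Measure X).real E - (ν : Measure X).real E| ≤ tvDist μ ν := by
  have hbdd : BddAbove (Set.range fun E : {E : Set X // MeasurableSet E} =>
      |(μ : Measure X).real (E : Set X) - (ν : Measure X).real (E : Set X)|) := by
    refine ⟨1, ?_⟩
    rintro _ ⟨E, rfl⟩
    exact abs_measureReal_sub_le_one μ ν E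
  exact le_ciSup hbdd ⟨E, hE⟩

lemma tvDist_le {μ ν : ProbabilityMeasure X} {c : ℝ}
    (h : ∀ E, MeasurableSet E → |(μ : Measure X).real E - (ν : Measure X).real E| ≤ c) :
    tvDist μ ν ≤ c := by
  have : Nonempty {E : Set X // MeasurableSet E} := ⟨⟨∅, MeasurableSet.empty⟩⟩
  exact ciSup_le fun E => h E E.2

lemma tvDist_nonneg (μ ν : ProbabilityMeasure X) : 0 ≤ tvDist μ ν :=
  (abs_nonneg _).trans (abs_measureReal_sub_le_tvDist μ ν MeasurableSet.empty)

lemma tvDist_triangle (μ ν ξ : ProbabilityMeasure X) :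
    tvDist μ ξ ≤ tvDist μ ν + tvDist ν ξ :=
  tvDist_le fun _ hE => (abs_sub_le _ _ _).trans
    (add_le_add (abs_measureReal_sub_le_tvDist μ ν hE) (abs_measureReal_sub_le_tvDist ν ξ hE))

lemma distToClass_nonneg (g : ProbabilityMeasure X) (F : Set (ProbabilityMeasure X)) :
    0 ≤ distToClass g F :=
  Real.iInf_nonneg fun f => tvDist_nonneg g f

/-- A sequence of measurable sets is *determining* if every discrepancy between two distributions
is already seen, up to an arbitrarily small error, on some set of the sequence: a uniform bound on
the sequence bounds the total variation distance. -/
def IsDetermining (A : ℕ → Set X) : Prop :=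
  (∀ k, MeasurableSet (A k)) ∧ ∀ (μ ν : ProbabilityMeasure X) (c : ℝ),
    (∀ k, |(μ : Measure X).real (A k) - (ν : Measure X).real (A k)| ≤ c) → tvDist μ ν ≤ c

/-- The countable algebra of sets generated by a countable generating family is dense in the
`σ`-algebra for the measure `μ + ν`, hence determining. -/
lemma exists_isDetermining (X : Type*) [MeasurableSpace X]
    [MeasurableSpace.CountablyGenerated X] : ∃ A : ℕ → Set X, IsDetermining A := by
  set 𝒜 := generateSetAlgebra (MeasurableSpace.countableGeneratingSet X) with h𝒜
  have hc : 𝒜.Countable :=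
    countable_generateSetAlgebra (MeasurableSpace.countable_countableGeneratingSet)
  have halg : IsSetAlgebra 𝒜 := isSetAlgebra_generateSetAlgebra
  have hgen : ‹MeasurableSpace X› = MeasurableSpace.generateFrom 𝒜 := by
    rw [h𝒜, generateFrom_generateSetAlgebra_eq,
      MeasurableSpace.generateFrom_countableGeneratingSet]
  obtain ⟨A, hA⟩ := hc.exists_eq_range ⟨∅, halg.empty_mem⟩
  have hmeas : ∀ k, MeasurableSet (A k) := fun k => by
    rw [hgen]
    exact MeasurableSpace.measurableSet_generateFrom (hA ▸ Set.mem_range_self k)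
  refine ⟨A, hmeas, fun μ ν c h => tvDist_le fun E hE => le_of_forall_pos_le_add fun r hr => ?_⟩
  have hdense := Measure.MeasureDense.of_generateFrom_isSetAlgebra_finite
    ((μ : Measure X) + (ν : Measure X)) halg hgen
  obtain ⟨t, ht, hlt⟩ := hdense.approx E hE (measure_ne_top _ _) r hr
  obtain ⟨k, rfl⟩ : ∃ k, A k = t := by rwa [hA] at ht
  have hlt' : (μ : Measure X).real (symmDiff E (A k)) + (ν : Measure X).real (symmDiff E (A k))
      ≤ r := by
    rw [measureReal_def, measureReal_def,
      ← ENNReal.toReal_add (measure_ne_top _ _) (measure_ne_top _ _)]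
    exact ENNReal.toReal_le_of_le_ofReal hr.le (by simpa using hlt.le)
  have hμ := abs_measureReal_sub_le_measureReal_symmDiff' (μ := (μ : Measure X))
    hE.nullMeasurableSet (hmeas k).nullMeasurableSet
    (measure_ne_top _ _) (measure_ne_top _ _)
  have hν := abs_measureReal_sub_le_measureReal_symmDiff' (μ := (ν : Measure X))
    hE.nullMeasurableSet (hmeas k).nullMeasurableSet
    (measure_ne_top _ _) (measure_ne_top _ _)
  have hk := h k
  rw [abs_le] at *
  constructor <;> linarith

variable {A : ℕ → Set X}

lemma IsDetermining.ext (hA : IsDetermining A) {μ ν : ProbabilityMeasure X}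
    (h : ∀ k, (μ : Measure X).real (A k) = (ν : Measure X).real (A k)) : μ = ν := by
  have h0 : tvDist μ ν ≤ 0 := hA.2 μ ν 0 fun k => by simp [h k]
  apply Subtype.ext
  ext E hE
  have hE0 := abs_measureReal_sub_le_tvDist μ ν hE
  have : (μ : Measure X).real E = (ν : Measure X).real E :=
    sub_eq_zero.mp (abs_eq_zero.mp (le_antisymm (hE0.trans h0) (abs_nonneg _)))
  exact (ENNReal.toReal_eq_toReal_iff' (measure_ne_top (μ : Measure X) E)
    (measure_ne_top (ν : Measure X) E)).mp this

lemma measurable_measureReal {E : Set X} (hE : MeasurableSet E) :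
    Measurable fun μ : ProbabilityMeasure X => (μ : Measure X).real E :=
  ((Measure.measurable_coe hE).comp measurable_subtype_coe).ennreal_toReal

lemma measurableSet_eq_probabilityMeasure [MeasurableSpace.CountablyGenerated X]
    {Ω : Type*} [MeasurableSpace Ω] {φ ψ : Ω → ProbabilityMeasure X}
    (hφ : Measurable φ) (hψ : Measurable ψ) : MeasurableSet {ω | φ ω = ψ ω} := by
  obtain ⟨A, hA⟩ := exists_isDetermining X
  have : {ω | φ ω = ψ ω} =
      ⋂ k, {ω | (φ ω : Measure X).real (A k) = (ψ ω : Measure X).real (A k)} := by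
    ext ω
    simp only [Set.mem_ofPred_eq, Set.mem_iInter]
    exact ⟨fun h k => by rw [h], fun h => hA.ext h⟩
  rw [this]
  exact MeasurableSet.iInter fun k => measurableSet_eq_fun
    ((measurable_measureReal (hA.1 k)).comp hφ) ((measurable_measureReal (hA.1 k)).comp hψ)

lemma measurableSet_tvDist_le [MeasurableSpace.CountablyGenerated X]
    (g : ProbabilityMeasure X) (c : ℝ) : MeasurableSet {f | tvDist f g ≤ c} := by
  obtain ⟨A, hA⟩ := exists_isDetermining X
  have : {f | tvDist f g ≤ c} =
      ⋂ k, {f : ProbabilityMeasure X |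
        |(f : Measure X).real (A k) - (g : Measure X).real (A k)| ≤ c} := by
    ext f
    simp only [Set.mem_ofPred_eq, Set.mem_iInter]
    exact ⟨fun h k => (abs_measureReal_sub_le_tvDist f g (hA.1 k)).trans h, hA.2 f g c⟩
  rw [this]
  exact MeasurableSet.iInter fun k => measurableSet_le
    (((measurable_measureReal (hA.1 k)).sub measurable_const).abs) measurable_const

lemma measurableSet_lt_tvDist [MeasurableSpace.CountablyGenerated X]
    (g : ProbabilityMeasure X) (c : ℝ) : MeasurableSet {f | c < tvDist f g} := by
  simpa [Set.compl_def] using (measurableSet_tvDist_le g c).compl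

/-! ### Separating sets -/

/-- `A k` maximises the discrepancy of `f` and `f'` over the sequence, up to an error `η`. -/
def IsSeparatingIndex (A : ℕ → Set X) (η : ℝ) (f f' : ProbabilityMeasure X) (k : ℕ) : Prop :=
  ∀ l, |(f : Measure X).real (A l) - (f' : Measure X).real (A l)| ≤
    |(f : Measure X).real (A k) - (f' : Measure X).real (A k)| + η

lemma exists_isSeparatingIndex (A : ℕ → Set X) {η : ℝ} (hη : 0 < η)
    (f f' : ProbabilityMeasure X) : ∃ k, IsSeparatingIndex A η f f' k := by
  have hbdd : BddAbove (Set.range fun l =>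
      |(f : Measure X).real (A l) - (f' : Measure X).real (A l)|) := by
    refine ⟨1, ?_⟩
    rintro _ ⟨l, rfl⟩
    exact abs_measureReal_sub_le_one f f' (A l)
  obtain ⟨k, hk⟩ := exists_lt_of_lt_ciSup (sub_lt_self (⨆ l,
      |(f : Measure X).real (A l) - (f' : Measure X).real (A l)|) hη)
  exact ⟨k, fun l => by linarith [le_ciSup hbdd l]⟩

open Classical in
/-- The first index of a set of the sequence nearly separating `f` from `f'` (and `0` if there is
none). It replaces the Scheffé set `{df/dν > df'/dν}`: taking the first index of a sequence makes
the choice jointly measurable in `f` and `f'`, with no choice of densities. -/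
noncomputable def sepIndex (A : ℕ → Set X) (η : ℝ) (f f' : ProbabilityMeasure X) : ℕ :=
  if h : ∃ k, IsSeparatingIndex A η f f' k then Nat.find h else 0

lemma sepIndex_comm (A : ℕ → Set X) (η : ℝ) (f f' : ProbabilityMeasure X) :
    sepIndex A η f f' = sepIndex A η f' f := by
  have : IsSeparatingIndex A η f f' = IsSeparatingIndex A η f' f := by
    ext k
    unfold IsSeparatingIndex
    simp_rw [abs_sub_comm]
  unfold sepIndex
  rw [this]

lemma tvDist_le_sepIndex (hA : IsDetermining A) {η : ℝ} (hη : 0 < η)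
    (f f' : ProbabilityMeasure X) :
    tvDist f f' ≤ |(f : Measure X).real (A (sepIndex A η f f')) -
      (f' : Measure X).real (A (sepIndex A η f f'))| + η := by
  classical
  have h := exists_isSeparatingIndex A hη f f'
  have hs : IsSeparatingIndex A η f f' (sepIndex A η f f') := by
    rw [sepIndex, dif_pos h]
    exact Nat.find_spec h
  exact hA.2 f f' _ hs

lemma measurable_sepIndex (hA : ∀ k, MeasurableSet (A k)) {η : ℝ} (hη : 0 < η) :
    Measurable fun p : ProbabilityMeasure X × ProbabilityMeasure X =>
      sepIndex A η p.1 p.2 := by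
  classical
  have hm : ∀ k, Measurable fun p : ProbabilityMeasure X × ProbabilityMeasure X =>
      |(p.1 : Measure X).real (A k) - (p.2 : Measure X).real (A k)| := fun k =>
    (((measurable_measureReal (hA k)).comp measurable_fst).sub
      ((measurable_measureReal (hA k)).comp measurable_snd)).abs
  have := measurable_find
    (p := fun (p : ProbabilityMeasure X × ProbabilityMeasure X) k =>
      IsSeparatingIndex A η p.1 p.2 k)
    (fun p => exists_isSeparatingIndex A hη p.1 p.2) fun k => by
      have : {p : ProbabilityMeasure X × ProbabilityMeasure X | IsSeparatingIndex A η p.1 p.2 k} =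
        ⋂ l, {p | |(p.1 : Measure X).real (A l) - (p.2 : Measure X).real (A l)| ≤
          |(p.1 : Measure X).real (A k) - (p.2 : Measure X).real (A k)| + η} := by
        ext p
        simp [IsSeparatingIndex]
      rw [this]
      exact MeasurableSet.iInter fun l => measurableSet_le (hm l) ((hm k).add_const η)
  convert this using 2 with p
  rw [sepIndex, dif_pos (exists_isSeparatingIndex A hη p.1 p.2)]

end TotalVariation

/-! ### Finite products of probability measures -/

section Products

open scoped ENNReal

lemma lintegral_pi_prod {ι : Type*} [Fintype ι] {Y : ι → Type*} [∀ i, MeasurableSpace (Y i)]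
    (μ : ∀ i, Measure (Y i)) [∀ i, IsProbabilityMeasure (μ i)] {f : ∀ i, Y i → ℝ≥0∞}
    (hf : ∀ i, Measurable (f i)) :
    ∫⁻ y, ∏ i, f i (y i) ∂(Measure.pi μ) = ∏ i, ∫⁻ y, f i y ∂(μ i) := by
  refine (lintegral_prod_eq_prod_lintegral_of_indepFun (μ := Measure.pi μ) Finset.univ
    (fun i y => f i (y i)) (iIndepFun_pi fun i => (hf i).aemeasurable)
    fun i => (hf i).comp (measurable_pi_apply i)).trans ?_
  exact Finset.prod_congr rfl fun i _ =>
    (measurePreserving_eval μ i).lintegral_comp (hf i)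

/-- The product of finitely many Markov kernels with a common source. -/
noncomputable def piKernel {ι : Type*} [Fintype ι] {Ω : Type*} [MeasurableSpace Ω] {Y : ι → Type*}
    [∀ i, MeasurableSpace (Y i)] (κ : ∀ i, Kernel Ω (Y i)) [∀ i, IsMarkovKernel (κ i)] :
    Kernel Ω (∀ i, Y i) where
  toFun ω := Measure.pi fun i => κ i ω
  measurable' := by
    refine Measurable.measure_of_isPiSystem_of_isProbabilityMeasure generateFrom_pi.symm
      isPiSystem_pi ?_
    rintro _ ⟨s, hs, rfl⟩
    simp_rw [Measure.pi_pi]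
    exact Finset.measurable_prod _ fun i _ => (κ i).measurable_coe (hs i (Set.mem_univ i))

instance {ι : Type*} [Fintype ι] {Ω : Type*} [MeasurableSpace Ω] {Y : ι → Type*}
    [∀ i, MeasurableSpace (Y i)] (κ : ∀ i, Kernel Ω (Y i)) [∀ i, IsMarkovKernel (κ i)] :
    IsMarkovKernel (piKernel κ) :=
  ⟨fun ω => inferInstanceAs (IsProbabilityMeasure (Measure.pi fun i => κ i ω))⟩

/-- Reading distinct coordinates of an i.i.d. family again gives an i.i.d. family. -/
lemma measurePreserving_reindex {ι κ X : Type*} [Fintype ι] [Fintype κ] [MeasurableSpace X]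
    (μ : Measure X) [IsProbabilityMeasure μ] {e : κ → ι} (he : e.Injective) :
    MeasurePreserving (fun (x : ι → X) k => x (e k)) (Measure.pi fun _ => μ)
      (Measure.pi fun _ => μ) := by
  refine ⟨by fun_prop, ?_⟩
  have hind : iIndepFun (fun (i : ι) (x : ι → X) => x i) (Measure.pi fun _ => μ) :=
    iIndepFun_pi (X := fun _ x => x) fun _ => aemeasurable_id
  have := (iIndepFun_iff_map_fun_eq_pi_map
    (fun k => (measurable_pi_apply (e k)).aemeasurable)).mp (hind.precomp he)
  rw [this]
  congr 1
  ext1 k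
  exact (measurePreserving_eval (fun _ : ι => μ) (e k)).map_eq

lemma measurePreserving_curry {ι κ X : Type*} [Fintype ι] [Fintype κ] [MeasurableSpace X]
    (μ : Measure X) [IsProbabilityMeasure μ] :
    MeasurePreserving (fun (x : ι × κ → X) i k => x (i, k)) (Measure.pi fun _ => μ)
      (Measure.pi fun _ => Measure.pi fun _ => μ) := by
  have hu : Measurable fun (y : ι → κ → X) (p : ι × κ) => y p.1 p.2 := by fun_prop
  have hc : Measurable fun (x : ι × κ → X) i k => x (i, k) := by fun_prop
  refine ⟨hc, ?_⟩
  have : Measure.pi (fun _ : ι × κ => μ) = Measure.map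
      (fun (y : ι → κ → X) (p : ι × κ) => y p.1 p.2)
      (Measure.pi fun _ => Measure.pi fun _ => μ) := by
    refine Measure.pi_eq fun s hs => ?_
    rw [Measure.map_apply hu (MeasurableSet.univ_pi hs)]
    have : (fun (y : ι → κ → X) (p : ι × κ) => y p.1 p.2) ⁻¹' Set.univ.pi s =
        Set.univ.pi fun i => Set.univ.pi fun k => s (i, k) := by
      ext y
      simp [Set.mem_pi]
    rw [this]
    simp_rw [Measure.pi_pi]
    rw [Fintype.prod_prod_type]
  rw [this, Measure.map_map hc hu]
  exact Measure.map_id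

/-- An i.i.d. family, cut along disjoint groups of coordinates, consists of independent i.i.d.
blocks. -/
lemma measurePreserving_blocks {ι τ κ κ' X : Type*} [Fintype ι] [Fintype τ] [Fintype κ]
    [Fintype κ'] [MeasurableSpace X] (μ : Measure X) [IsProbabilityMeasure μ]
    {e : (τ × κ) ⊕ (τ × κ') → ι} (he : e.Injective) :
    MeasurePreserving
      (fun x : ι → X => ((fun t j => x (e (.inl (t, j))) : τ → κ → X),
        (fun t j => x (e (.inr (t, j))) : τ → κ' → X)))
      (Measure.pi fun _ => μ)
      ((Measure.pi fun _ => Measure.pi fun _ => μ).prod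
        (Measure.pi fun _ => Measure.pi fun _ => μ)) :=
  ((measurePreserving_curry μ).prod (measurePreserving_curry μ)).comp
    ((measurePreserving_sumPiEquivProdPi (X := fun _ : (τ × κ) ⊕ (τ × κ') => X)
      fun _ => μ).comp (measurePreserving_reindex μ he))

/-- Resampling one coordinate turns a product measure into the product measure with that factor
replaced. -/
lemma map_update_pi {ι Y : Type*} [Fintype ι] [DecidableEq ι] [MeasurableSpace Y]
    (ν ν' : ι → Measure Y) [∀ i, IsProbabilityMeasure (ν i)] [∀ i, IsProbabilityMeasure (ν' i)]
    (i₀ : ι) (h : ∀ i, i ≠ i₀ → ν i = ν' i) :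
    MeasurePreserving (fun p : (ι → Y) × Y => Function.update p.1 i₀ p.2)
      ((Measure.pi ν).prod (ν' i₀)) (Measure.pi ν') := by
  have hm : Measurable fun p : (ι → Y) × Y => Function.update p.1 i₀ p.2 := by
    refine measurable_pi_lambda _ fun i => ?_
    by_cases hi : i = i₀
    · subst hi
      simpa using measurable_snd
    · simp only [Function.update_of_ne hi]
      fun_prop
  refine ⟨hm, Eq.symm (Measure.pi_eq fun s hs => ?_)⟩
  rw [Measure.map_apply hm (MeasurableSet.univ_pi hs)]
  have : (fun p : (ι → Y) × Y => Function.update p.1 i₀ p.2) ⁻¹' Set.univ.pi s =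
      (Set.univ.pi (Function.update s i₀ Set.univ)) ×ˢ s i₀ := by
    ext p
    simp only [Set.mem_preimage, Set.mem_pi, Set.mem_univ, true_imp_iff, Set.mem_prod]
    constructor
    · refine fun hp => ⟨fun i => ?_, by simpa using hp i₀⟩
      by_cases hi : i = i₀
      · subst hi; simp
      · simpa [hi] using hp i
    · rintro ⟨hp, hp'⟩ i
      by_cases hi : i = i₀
      · subst hi; simpa using hp'
      · simpa [hi] using hp i
  rw [this, Measure.prod_prod, Measure.pi_pi, ← Finset.prod_erase_mul _ _ (Finset.mem_univ i₀),
    ← Finset.prod_erase_mul _ (fun i => ν' i (s i)) (Finset.mem_univ i₀)]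
  simp only [Function.update_self, measure_univ, mul_one]
  congr 1
  refine Finset.prod_congr rfl fun i hi => ?_
  have hi := (Finset.mem_erase.mp hi).1
  simp [hi, h i hi]

/-- Indistinguishability of all pairs of inputs that agree off one coordinate passes to product
measures that differ in one factor: resample that coordinate. -/
lemma lintegral_pi_le_of_differ_at {ι Y : Type*} [Fintype ι] [MeasurableSpace Y]
    (ν ν' : ι → Measure Y) [∀ i, IsProbabilityMeasure (ν i)] [∀ i, IsProbabilityMeasure (ν' i)]
    (i₀ : ι) (h : ∀ i, i ≠ i₀ → ν i = ν' i) {a a' : (ι → Y) → ℝ≥0∞} (ha : Measurable a)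
    (ha' : Measurable a') (c d : ℝ≥0∞)
    (hle : ∀ H H', (∀ i, i ≠ i₀ → H i = H' i) → a H ≤ c * a' H' + d) :
    ∫⁻ H, a H ∂(Measure.pi ν) ≤ c * ∫⁻ H, a' H ∂(Measure.pi ν') + d := by
  classical
  have hup := map_update_pi ν ν' i₀ h
  have hfst : MeasurePreserving Prod.fst ((Measure.pi ν).prod (ν' i₀)) (Measure.pi ν) :=
    measurePreserving_fst
  calc ∫⁻ H, a H ∂(Measure.pi ν)
      = ∫⁻ p, a p.1 ∂((Measure.pi ν).prod (ν' i₀)) := (hfst.lintegral_comp ha).symm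
    _ ≤ ∫⁻ p, (c * a' (Function.update p.1 i₀ p.2) + d) ∂((Measure.pi ν).prod (ν' i₀)) :=
        lintegral_mono fun p => hle _ _ fun i hi => (Function.update_of_ne hi _ _).symm
    _ = c * ∫⁻ H, a' H ∂(Measure.pi ν') + d := by
        have hm : Measurable fun p : (ι → Y) × Y => a' (Function.update p.1 i₀ p.2) :=
          ha'.comp hup.measurable
        rw [lintegral_add_right _ measurable_const, lintegral_const_mul _ hm,
          hup.lintegral_comp ha']
        simp

end Products

/-! ### Concentration -/

section Concentration

open scoped ENNReal

/-- The constant behind the Chernoff bound `exp (-τ / 2)` for `10 τ` trials, each failing with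
probability at most `0.09`, of which more than `2 τ` fail. -/
lemma chernoff_constant : (1.09 : ℝ) ^ 10 * Real.exp (1 / 2) ≤ 4 := by
  have h1 : Real.exp (1 / 2) ≤ 1.65 := by
    refine le_of_sq_le_sq ?_ (by norm_num)
    rw [← Real.exp_nat_mul]
    norm_num
    linarith [Real.exp_one_lt_d9]
  calc (1.09 : ℝ) ^ 10 * Real.exp (1 / 2) ≤ (1.09 : ℝ) ^ 10 * 1.65 := by gcongr
    _ ≤ 4 := by norm_num

open Classical in
/-- Chernoff's bound for two-step sampling: `z t` is drawn from `P`, then `H t` from `κ (z t)`,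
independently for `10 τ` values of `t`. If `H t ∈ B` has probability at least `0.91`, then it holds
for at least `8 τ` values of `t` except with exponentially small probability. The moment used is
that of `2 ^ (number of failures)`. -/
lemma lintegral_pi_few_successes_le {Z Y : Type*} [MeasurableSpace Z] [MeasurableSpace Y]
    (P : Measure Z) [IsProbabilityMeasure P] (κ : Kernel Z Y) [IsMarkovKernel κ] {B : Set Y}
    (hB : MeasurableSet B) (hP : ENNReal.ofReal 0.91 ≤ (κ ∘ₘ P) B) (τ : ℕ) :
    ∫⁻ z, (Measure.pi fun t : Fin (10 * τ) => κ (z t))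
        {H | (Finset.univ.filter fun t => H t ∈ B).card < 8 * τ} ∂(Measure.pi fun _ => P) ≤
      ENNReal.ofReal (Real.exp (-(τ / 2 : ℝ))) := by
  set x : Y → ℝ≥0∞ := fun y => 1 + Bᶜ.indicator 1 y with hx
  have hxm : Measurable x := (measurable_one.indicator hB.compl).const_add 1
  have hmean : ∫⁻ y, x y ∂(κ ∘ₘ P) ≤ ENNReal.ofReal 1.09 := by
    have hc : (κ ∘ₘ P) Bᶜ ≤ ENNReal.ofReal 0.09 := by
      rw [prob_compl_eq_one_sub hB]
      calc 1 - (κ ∘ₘ P) B ≤ 1 - ENNReal.ofReal 0.91 := tsub_le_tsub_left hP 1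
        _ = ENNReal.ofReal 0.09 := by
          rw [← ENNReal.ofReal_one, ← ENNReal.ofReal_sub _ (by norm_num)]; norm_num
    calc ∫⁻ y, x y ∂(κ ∘ₘ P) = 1 + (κ ∘ₘ P) Bᶜ := by
          rw [hx, lintegral_add_left measurable_const, lintegral_indicator_one hB.compl]
          simp
      _ ≤ ENNReal.ofReal 1 + ENNReal.ofReal 0.09 := by
          rw [ENNReal.ofReal_one]; gcongr
      _ = ENNReal.ofReal 1.09 := by rw [← ENNReal.ofReal_add] <;> norm_num
  have hmarkov : ∀ z : Fin (10 * τ) → Z, 4 ^ τ * (Measure.pi fun t => κ (z t))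
      {H | (Finset.univ.filter fun t => H t ∈ B).card < 8 * τ} ≤
      ∏ t, ∫⁻ y, x y ∂(κ (z t)) := by
    intro z
    rw [← lintegral_pi_prod (fun t => κ (z t)) (f := fun _ => x) fun _ => hxm]
    refine le_trans ?_ (mul_meas_ge_le_lintegral
      (Finset.measurable_prod _ fun t _ => hxm.comp (measurable_pi_apply t)) (4 ^ τ))
    gcongr 4 ^ τ * ?_
    refine measure_mono fun H hH => ?_
    have hH : (Finset.univ.filter fun t => H t ∈ B).card < 8 * τ := hH
    have hprod : ∏ t, x (H t) = 2 ^ (Finset.univ.filter fun t => H t ∉ B).card := by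
      have : ∀ t, x (H t) = if H t ∉ B then 2 else 1 := by
        intro t
        by_cases h : H t ∈ B <;> simp [hx, h, one_add_one_eq_two]
      simp_rw [this]
      rw [Finset.prod_ite]
      simp
    have hcard := Finset.card_filter_add_card_filter_not
      (s := (Finset.univ : Finset (Fin (10 * τ)))) (fun t => H t ∈ B)
    rw [Finset.card_univ, Fintype.card_fin] at hcard
    change (4 : ℝ≥0∞) ^ τ ≤ ∏ t, x (H t)
    rw [hprod, show (4 : ℝ≥0∞) = 2 ^ 2 by norm_num, ← pow_mul]
    exact pow_le_pow_right₀ (by norm_num) (by omega)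
  have hint : 4 ^ τ * ∫⁻ z, (Measure.pi fun t : Fin (10 * τ) => κ (z t))
        {H | (Finset.univ.filter fun t => H t ∈ B).card < 8 * τ} ∂(Measure.pi fun _ => P) ≤
      ENNReal.ofReal 1.09 ^ (10 * τ) := by
    rw [← lintegral_const_mul' _ _ (by simp)]
    calc _ ≤ ∫⁻ z, ∏ t, ∫⁻ y, x y ∂(κ (z t)) ∂(Measure.pi fun _ => P) :=
          lintegral_mono hmarkov
      _ = ∏ _t : Fin (10 * τ), ∫⁻ z, ∫⁻ y, x y ∂(κ z) ∂P :=
          lintegral_pi_prod (fun _ => P) (f := fun _ z => ∫⁻ y, x y ∂(κ z))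
            fun _ => hxm.lintegral_kernel
      _ = (∫⁻ y, x y ∂(κ ∘ₘ P)) ^ (10 * τ) := by
          rw [Finset.prod_const, Finset.card_univ, Fintype.card_fin,
            Measure.lintegral_bind κ.aemeasurable hxm.aemeasurable]
      _ ≤ ENNReal.ofReal 1.09 ^ (10 * τ) := by gcongr
  have hnum : ENNReal.ofReal 1.09 ^ (10 * τ) ≤
      4 ^ τ * ENNReal.ofReal (Real.exp (-(τ / 2 : ℝ))) := by
    rw [show (4 : ℝ≥0∞) = ENNReal.ofReal 4 by simp, ← ENNReal.ofReal_pow (by norm_num),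
      ← ENNReal.ofReal_pow (by norm_num), ← ENNReal.ofReal_mul (by positivity)]
    refine ENNReal.ofReal_le_ofReal ?_
    have h := pow_le_pow_left₀ (by positivity) chernoff_constant τ
    rw [mul_pow, ← pow_mul, ← Real.exp_nat_mul, mul_one_div] at h
    rw [Real.exp_neg, ← div_eq_mul_inv, le_div_iff₀ (Real.exp_pos _)]
    exact h
  exact (ENNReal.mul_le_mul_iff_right (by simp) (by simp)).mp (hint.trans hnum)

/-- The empirical frequency of `A` in the sample `y` (it is `0` for the empty sample). -/
noncomputable def empFreq {X : Type*} {s : ℕ} (y : Fin s → X) (A : Set X) : ℝ :=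
  (∑ j, A.indicator 1 (y j)) / s

lemma measurable_empFreq {X : Type*} [MeasurableSpace X] {s : ℕ} {A : Set X}
    (hA : MeasurableSet A) : Measurable fun y : Fin s → X => empFreq y A :=
  (Finset.measurable_sum _ fun j _ =>
    (measurable_one.indicator hA).comp (measurable_pi_apply j)).div_const _

/-- Hoeffding's inequality for the empirical frequency of an event. -/
lemma measure_empFreq_dev_le {X : Type*} [MeasurableSpace X] (g : Measure X)
    [IsProbabilityMeasure g] {A : Set X} (hA : MeasurableSet A) {s : ℕ} (hs : 0 < s) {η : ℝ}
    (hη : 0 ≤ η) :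
    (Measure.pi fun _ : Fin s => g) {y | η < |empFreq y A - g.real A|} ≤
      ENNReal.ofReal (2 * Real.exp (-(2 * s * η ^ 2))) := by
  set X₀ : X → ℝ := fun x => A.indicator 1 x - g.real A with hX₀
  have hX₀m : Measurable X₀ := (measurable_one.indicator hA).sub_const _
  have hsub : HasSubgaussianMGF X₀ ((‖(1 : ℝ) - 0‖₊ / 2) ^ 2) g := by
    have := hasSubgaussianMGF_of_mem_Icc (μ := g) (X := A.indicator (1 : X → ℝ)) (a := 0) (b := 1)
      (measurable_one.indicator hA).aemeasurable (Filter.Eventually.of_forall fun x => by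
        by_cases hx : x ∈ A <;> simp [hx])
    rwa [integral_indicator_one hA] at this
  have hs' : (0 : ℝ) < s := by exact_mod_cast hs
  have key : ∀ X₁ : X → ℝ, Measurable X₁ →
      HasSubgaussianMGF X₁ ((‖(1 : ℝ) - 0‖₊ / 2) ^ 2) g →
      (Measure.pi fun _ : Fin s => g).real {y | s * η ≤ ∑ j, X₁ (y j)} ≤
        Real.exp (-(2 * s * η ^ 2)) := by
    intro X₁ hm hX₁
    have hind : iIndepFun (fun (j : Fin s) (y : Fin s → X) => X₁ (y j))
        (Measure.pi fun _ => g) := iIndepFun_pi fun _ => hm.aemeasurable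
    have hj : ∀ j ∈ (Finset.univ : Finset (Fin s)),
        HasSubgaussianMGF (fun y : Fin s → X => X₁ (y j)) ((‖(1 : ℝ) - 0‖₊ / 2) ^ 2)
          (Measure.pi fun _ => g) := by
      intro j _
      have hev := measurePreserving_eval (fun _ : Fin s => g) j
      refine HasSubgaussianMGF.of_map hev.measurable.aemeasurable (X := X₁) ?_
      rwa [hev.map_eq]
    refine (HasSubgaussianMGF.measure_sum_ge_le_of_iIndepFun hind hj
      (ε := s * η) (by positivity)).trans (le_of_eq ?_)
    congr 1
    simp
    field_simp
  have hdev : ∀ y : Fin s → X, ∑ j, X₀ (y j) = s * (empFreq y A - g.real A) := by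
    intro y
    simp only [hX₀, empFreq, Finset.sum_sub_distrib, Finset.sum_const, Finset.card_univ,
      Fintype.card_fin, nsmul_eq_mul]
    field_simp
  have hcover : {y : Fin s → X | η < |empFreq y A - g.real A|} ⊆
      {y | s * η ≤ ∑ j, X₀ (y j)} ∪ {y | s * η ≤ ∑ j, -X₀ (y j)} := by
    intro y hy
    have hy : η < |empFreq y A - g.real A| := hy
    rcases lt_abs.mp hy with h | h
    · left
      change s * η ≤ ∑ j, X₀ (y j)
      rw [hdev]
      exact mul_le_mul_of_nonneg_left h.le hs'.le
    · right
      change s * η ≤ ∑ j, -X₀ (y j)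
      rw [Finset.sum_neg_distrib, hdev, ← mul_neg]
      exact mul_le_mul_of_nonneg_left h.le hs'.le
  calc _ ≤ (Measure.pi fun _ : Fin s => g) ({y | s * η ≤ ∑ j, X₀ (y j)} ∪
        {y | s * η ≤ ∑ j, -X₀ (y j)}) := measure_mono hcover
    _ = ENNReal.ofReal ((Measure.pi fun _ : Fin s => g).real _) := (ofReal_measureReal).symm
    _ ≤ _ := ENNReal.ofReal_le_ofReal ((measureReal_union_le _ _).trans (by
        rw [two_mul (Real.exp _)]
        exact add_le_add (key X₀ hX₀m hsub) (key (fun x => -X₀ x) hX₀m.neg hsub.neg)))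

end Concentration

/-! ### Scoring candidates by the votes of independent blocks -/

section Scoring

open Classical

variable {P : Type*} {τ : ℕ}

/-- The number of blocks whose list contains `f`; `mem t f` says that block `t` lists `f`. -/
noncomputable def listCount (mem : Fin (10 * τ) → P → Prop) (f : P) : ℕ :=
  (Finset.univ.filter fun t => mem t f).card

/-- The number of blocks in which `f` passes, at level `i`, the test against `f'`. -/
noncomputable def passCount (pass : Fin (10 * τ) → ℕ → P → P → Prop) (i : ℕ) (f f' : P) : ℕ :=
  (Finset.univ.filter fun t => pass t i f f').card

/-- `f` qualifies with margin `k` at level `i`: it is listed by at least `k` blocks, and it passes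
in at least `k` blocks the level-`i` test against every competitor that is missing from fewer than
`k` of the lists. -/
def Qualifies (mem : Fin (10 * τ) → P → Prop) (pass : Fin (10 * τ) → ℕ → P → P → Prop)
    (i : ℕ) (f : P) (k : ℕ) : Prop :=
  k ≤ listCount mem f ∧ ∀ f', listCount mem f' + k ≤ 10 * τ ∨ k ≤ passCount pass i f f'

/-- `f` qualifies at some level `i` (with margin `3 τ + k`) at which the previous level is
strict enough to disqualify every candidate (with margin `7 τ - k`). Both requirements become
stronger as `k` grows, for `k ≤ 7 τ`. For `1 ≤ k ≤ 2 τ` the margins keep to either side of `5 τ` and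
between `2 τ` and `8 τ`: a distribution on `8 τ` lists is a competitor for every margin above `2 τ`,
and can itself qualify with every margin up to `8 τ`. -/
def Stands (mem : Fin (10 * τ) → P → Prop) (pass : Fin (10 * τ) → ℕ → P → P → Prop)
    (f : P) (k : ℕ) : Prop :=
  ∃ i, Qualifies mem pass i f (3 * τ + k) ∧
    (i = 0 ∨ ∀ f', ¬ Qualifies mem pass (i - 1) f' (7 * τ - k))

/-- The number of margins `1 ≤ k ≤ 2 τ` with which `f` stands. -/
noncomputable def score (mem : Fin (10 * τ) → P → Prop)
    (pass : Fin (10 * τ) → ℕ → P → P → Prop) (f : P) : ℕ :=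
  ((Finset.Icc 1 (2 * τ)).filter fun k => Stands mem pass f k).card

variable {mem mem' : Fin (10 * τ) → P → Prop} {pass pass' : Fin (10 * τ) → ℕ → P → P → Prop}

lemma card_filter_le_succ_of_differ_at {T : ℕ} {p q : Fin T → Prop} (t₀ : Fin T)
    (h : ∀ t, t ≠ t₀ → (p t ↔ q t)) :
    (Finset.univ.filter p).card ≤ (Finset.univ.filter q).card + 1 := by
  calc (Finset.univ.filter p).card ≤ (insert t₀ (Finset.univ.filter q)).card := by
        refine Finset.card_le_card fun t ht => ?_
        by_cases htt : t = t₀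
        · simp [htt]
        · have := (h t htt).mp (Finset.mem_filter.mp ht).2
          simp [this]
    _ ≤ _ := Finset.card_insert_le _ _

lemma listCount_le (mem : Fin (10 * τ) → P → Prop) (f : P) : listCount mem f ≤ 10 * τ :=
  (Finset.card_filter_le _ _).trans (by simp)

lemma listCount_pos_iff {f : P} : 0 < listCount mem f ↔ ∃ t, mem t f := by
  simp [listCount, Finset.card_pos, Finset.filter_nonempty_iff]

lemma Qualifies.of_differ_at {t₀ : Fin (10 * τ)} (hm : ∀ t, t ≠ t₀ → mem t = mem' t)
    (hp : ∀ t, t ≠ t₀ → pass t = pass' t) {i : ℕ} {f : P} {k : ℕ}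
    (h : Qualifies mem pass i f (k + 1)) : Qualifies mem' pass' i f k := by
  have hc : listCount mem f ≤ listCount mem' f + 1 :=
    card_filter_le_succ_of_differ_at t₀ fun t ht => by rw [hm t ht]
  refine ⟨by have := h.1; omega, fun f' => ?_⟩
  have hc' : listCount mem' f' ≤ listCount mem f' + 1 :=
    card_filter_le_succ_of_differ_at t₀ fun t ht => by rw [hm t ht]
  have hv : passCount pass i f f' ≤ passCount pass' i f f' + 1 :=
    card_filter_le_succ_of_differ_at t₀ fun t ht => by rw [hp t ht]
  rcases h.2 f' with h2 | h2
  · left; omega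
  · right; omega

lemma Qualifies.mono {i : ℕ} {f : P} {k l : ℕ} (hkl : k ≤ l) (h : Qualifies mem pass i f l) :
    Qualifies mem pass i f k :=
  ⟨hkl.trans h.1, fun f' => (h.2 f').imp (fun h => by omega) fun h => hkl.trans h⟩

/-- Changing the data of one block changes every score by at most one. -/
lemma score_le_succ_of_differ_at {t₀ : Fin (10 * τ)} (hm : ∀ t, t ≠ t₀ → mem t = mem' t)
    (hp : ∀ t, t ≠ t₀ → pass t = pass' t) (f : P) :
    score mem pass f ≤ score mem' pass' f + 1 := by
  have hstep : ∀ k, k + 1 ≤ 2 * τ → Stands mem pass f (k + 1) → Stands mem' pass' f k := by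
    rintro k hk ⟨i, hi, hi'⟩
    refine ⟨i, Qualifies.of_differ_at hm hp hi, hi'.imp_right fun h f' hf' => h f' ?_⟩
    refine Qualifies.of_differ_at (fun t ht => (hm t ht).symm) (fun t ht => (hp t ht).symm)
      (t₀ := t₀) ?_
    rwa [show 7 * τ - (k + 1) + 1 = 7 * τ - k by omega]
  calc score mem pass f
      ≤ (insert 1 (((Finset.Icc 1 (2 * τ)).filter fun k => Stands mem' pass' f k).image
          fun k => k + 1)).card := by
        refine Finset.card_le_card fun k hk => ?_
        obtain ⟨hk, hS⟩ := Finset.mem_filter.mp hk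
        rw [Finset.mem_Icc] at hk
        rw [Finset.mem_insert]
        by_cases h1 : k = 1
        · exact Or.inl h1
        · right
          refine Finset.mem_image.mpr ⟨k - 1, Finset.mem_filter.mpr
            ⟨Finset.mem_Icc.mpr ⟨by omega, by omega⟩, hstep _ (by omega) ?_⟩, by omega⟩
          rwa [show k - 1 + 1 = k by omega]
    _ ≤ _ := (Finset.card_insert_le _ _).trans (Nat.add_le_add_right Finset.card_image_le 1)

lemma exists_stands_of_score_pos {f : P} (h : 0 < score mem pass f) :
    ∃ k, 1 ≤ k ∧ k ≤ 2 * τ ∧ Stands mem pass f k := by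
  obtain ⟨k, hk⟩ := Finset.card_pos.mp h
  obtain ⟨hk, hS⟩ := Finset.mem_filter.mp hk
  exact ⟨k, (Finset.mem_Icc.mp hk).1, (Finset.mem_Icc.mp hk).2, hS⟩

lemma listCount_of_score_pos {f : P} (h : 0 < score mem pass f) : 3 * τ < listCount mem f := by
  obtain ⟨k, hk, -, i, hi, -⟩ := exists_stands_of_score_pos h
  have := hi.1
  omega

/-- The list of block `t` contains `f`. -/
def IsListed {T L : ℕ} (H : Fin T → Fin L → P) (t : Fin T) (f : P) : Prop :=
  ∃ j, H t j = f

/-- A candidate of positive score fills more than `3 τ` of the `10 τ L` places in the lists. -/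
lemma card_score_pos_le {L : ℕ} (H : Fin (10 * τ) → Fin L → P)
    (pass : Fin (10 * τ) → ℕ → P → P → Prop) (U : Finset P) :
    (U.filter fun f => 0 < score (IsListed H) pass f).card ≤ 4 * L := by
  set V := U.filter fun f => 0 < score (IsListed H) pass f with hV
  rcases Nat.eq_zero_or_pos τ with h0 | hτ
  · have : V = ∅ := by
      refine Finset.filter_eq_empty_iff.mpr fun f _ hf => ?_
      obtain ⟨k, h1, h2, -⟩ := exists_stands_of_score_pos hf
      omega
    simp [this]
  have hlow : V.card * (3 * τ) ≤
      ∑ f ∈ V, (Finset.univ.filter fun p : Fin (10 * τ) × Fin L => H p.1 p.2 = f).card := by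
    rw [← smul_eq_mul, ← Finset.sum_const]
    refine Finset.sum_le_sum fun f hf => ?_
    have h1 := listCount_of_score_pos (Finset.mem_filter.mp hf).2
    refine h1.le.trans ?_
    unfold listCount
    refine (Finset.card_le_card (t := (Finset.univ.filter
      fun p : Fin (10 * τ) × Fin L => H p.1 p.2 = f).image Prod.fst) fun t ht => ?_).trans
      Finset.card_image_le
    obtain ⟨j, hj⟩ := (Finset.mem_filter.mp ht).2
    exact Finset.mem_image.mpr ⟨(t, j), by simp [hj], rfl⟩
  have hup : ∑ f ∈ V, (Finset.univ.filter fun p : Fin (10 * τ) × Fin L => H p.1 p.2 = f).card ≤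
      10 * τ * L := by
    rw [← Finset.card_biUnion fun f _ f' _ hff' => by
      rw [Function.onFun, Finset.disjoint_left]
      intro p hp hp'
      exact hff' ((Finset.mem_filter.mp hp).2.symm.trans (Finset.mem_filter.mp hp').2)]
    exact (Finset.card_le_univ _).trans (by simp)
  have : V.card * 3 ≤ 10 * L := by
    refine Nat.le_of_mul_le_mul_left ?_ hτ
    calc τ * (V.card * 3) = V.card * (3 * τ) := by ring
      _ ≤ 10 * τ * L := hlow.trans hup
      _ = τ * (10 * L) := by ring
  omega

section Accuracy

variable {f₀ : P} {θ : ℝ} (h₀ : 8 * τ ≤ listCount mem f₀)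
  (hpass : ∀ i : ℕ, θ ≤ i → ∀ f', 0 < listCount mem f' → ∀ t, pass t i f₀ f')

include h₀ hpass

lemma qualifies_of_le {i : ℕ} (hi : θ ≤ i) {k : ℕ} (hk : k ≤ 8 * τ) :
    Qualifies mem pass i f₀ k := by
  refine ⟨hk.trans h₀, fun f' => ?_⟩
  rcases Nat.eq_zero_or_pos (listCount mem f') with h | h
  · left; omega
  · right
    have : passCount pass i f₀ f' = 10 * τ := by
      simp [passCount, hpass i hi f' h]
    omega

/-- If `f₀` is listed by `8 τ` blocks and passes every test from level `θ` on, some candidate has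
the full score: any candidate that qualifies with margin `5 τ` at the first level at which one
does. -/
lemma exists_score_eq : ∃ f, score mem pass f = 2 * τ := by
  have hex : ∃ i, ∃ f, Qualifies mem pass i f (5 * τ) := by
    obtain ⟨i, hi⟩ := exists_nat_ge θ
    exact ⟨i, f₀, qualifies_of_le h₀ hpass hi (by omega)⟩
  obtain ⟨f, hf⟩ := Nat.find_spec hex
  refine ⟨f, ?_⟩
  have hall : ∀ k ∈ Finset.Icc 1 (2 * τ), Stands mem pass f k := by
    intro k hk
    rw [Finset.mem_Icc] at hk
    refine ⟨Nat.find hex, hf.mono (by omega), ?_⟩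
    rcases Nat.eq_zero_or_pos (Nat.find hex) with h0 | hpos
    · exact Or.inl h0
    · refine Or.inr fun f' hf' => Nat.find_min hex (m := Nat.find hex - 1) (by omega)
        ⟨f', hf'.mono (by omega)⟩
  rw [score, Finset.filter_true_of_mem hall]
  simp

/-- If `f₀` is listed by `8 τ` blocks and passes every test from level `θ` on, each candidate with
positive score passes a test against `f₀` at a level at most one above `θ`. -/
lemma exists_pass_of_score_pos {f : P} (hf : 0 < score mem pass f) :
    ∃ i : ℕ, (i = 0 ∨ (i : ℝ) < θ + 1) ∧ ∃ t, pass t i f f₀ := by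
  obtain ⟨k, hk, hk', i, hi, hi'⟩ := exists_stands_of_score_pos hf
  refine ⟨i, ?_, ?_⟩
  · refine hi'.imp_right fun h => ?_
    by_contra! hle
    rcases Nat.eq_zero_or_pos i with rfl | hipos
    · refine h f₀ (qualifies_of_le h₀ hpass ?_ (by omega))
      push_cast at hle ⊢
      linarith
    · refine h f₀ (qualifies_of_le h₀ hpass ?_ (by omega))
      rw [Nat.cast_sub hipos]
      push_cast
      linarith
  · rcases hi.2 f₀ with h | h
    · omega
    · have hpos : 0 < passCount pass i f f₀ := by omega
      obtain ⟨t, ht⟩ := Finset.card_pos.mp hpos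
      exact ⟨t, (Finset.mem_filter.mp ht).2⟩

end Accuracy

end Scoring

/-! ### Privacy of the selection rule -/

section Selection

open Classical in
/-- The probability of `E` when an element of `U` is drawn with weights `exp (ε s) - 1` and a
fallback, lying in `E` with probability `b`, with weight `W`. -/
noncomputable def selProb {P : Type*} (ε W b : ℝ) (s : P → ℕ) (U : Finset P) (E : P → Prop) : ℝ :=
  (W * b + ∑ f ∈ U.filter E, (Real.exp (ε * s f) - 1)) / (W + ∑ f ∈ U, (Real.exp (ε * s f) - 1))

lemma exp_mul_sub_one_nonneg {ε : ℝ} (hε : 0 ≤ ε) (n : ℕ) : 0 ≤ Real.exp (ε * n) - 1 := by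
  linarith [Real.add_one_le_exp (ε * n), mul_nonneg hε (Nat.cast_nonneg (α := ℝ) n)]

open Classical in
/-- The weight `exp (ε s) - 1` vanishes at score `0`, so an increase of the scores by one multiplies
the total weight by at most `exp ε`, up to an additive error for each element whose score becomes
positive. -/
lemma sum_weight_le {P : Type*} {ε : ℝ} (hε : 0 ≤ ε) {s s' : P → ℕ} (h : ∀ f, s f ≤ s' f + 1)
    {U : Finset P} {N : ℕ} (hN : (U.filter fun f => 0 < s f).card ≤ N) (V : Finset P)
    (hV : V ⊆ U) :
    ∑ f ∈ V, (Real.exp (ε * s f) - 1) ≤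
      Real.exp ε * ∑ f ∈ V, (Real.exp (ε * s' f) - 1) + (Real.exp ε - 1) * N := by
  have h1 : 1 ≤ Real.exp ε := Real.one_le_exp hε
  have hterm : ∀ f, Real.exp (ε * s f) - 1 ≤ Real.exp ε * (Real.exp (ε * s' f) - 1) +
      (if 0 < s f then (Real.exp ε - 1) else 0) := by
    intro f
    split_ifs with hf
    · have : Real.exp (ε * s f) ≤ Real.exp ε * Real.exp (ε * s' f) := by
        rw [← Real.exp_add]
        refine Real.exp_le_exp.mpr ?_
        have : (s f : ℝ) ≤ s' f + 1 := by exact_mod_cast h f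
        nlinarith
      linarith
    · have h0 : s f = 0 := by omega
      have := mul_nonneg (Real.exp_nonneg ε) (exp_mul_sub_one_nonneg hε (s' f))
      simp [h0, this]
  calc ∑ f ∈ V, (Real.exp (ε * s f) - 1)
      ≤ ∑ f ∈ V, (Real.exp ε * (Real.exp (ε * s' f) - 1) +
        (if 0 < s f then (Real.exp ε - 1) else 0)) := Finset.sum_le_sum fun f _ => hterm f
    _ = Real.exp ε * ∑ f ∈ V, (Real.exp (ε * s' f) - 1) +
        (V.filter fun f => 0 < s f).card * (Real.exp ε - 1) := by
        rw [Finset.sum_add_distrib, Finset.mul_sum, ← Finset.sum_filter, Finset.sum_const,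
          nsmul_eq_mul]
    _ ≤ _ := by
        rw [mul_comm (Real.exp ε - 1)]
        have hcard : ((V.filter fun f => 0 < s f).card : ℝ) ≤ N := by
          exact_mod_cast (Finset.card_le_card (Finset.filter_subset_filter _ hV)).trans hN
        have : 0 ≤ Real.exp ε - 1 := by linarith
        gcongr

open Classical in
lemma selProb_le {P : Type*} {ε W b : ℝ} (hε : 0 ≤ ε) (hW : 0 < W) (hb : 0 ≤ b) (hb' : b ≤ 1)
    {s s' : P → ℕ} (h : ∀ f, s f ≤ s' f + 1) (h' : ∀ f, s' f ≤ s f + 1) {U : Finset P} {N : ℕ}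
    (hN : (U.filter fun f => 0 < s f).card ≤ N) (hN' : (U.filter fun f => 0 < s' f).card ≤ N)
    (E : P → Prop) :
    selProb ε W b s U E ≤
      Real.exp (2 * ε) * selProb ε W b s' U E + (Real.exp (2 * ε) - 1) * N / W := by
  have h1 : 1 ≤ Real.exp ε := Real.one_le_exp hε
  have hsq : Real.exp (2 * ε) = Real.exp ε * Real.exp ε := by rw [← Real.exp_add]; ring_nf
  have hnum := sum_weight_le hε h hN (U.filter E) (Finset.filter_subset _ _)
  have hden := sum_weight_le hε h' hN' U subset_rfl
  have hx0 : 0 ≤ ∑ f ∈ U.filter E, (Real.exp (ε * s' f) - 1) :=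
    Finset.sum_nonneg fun f _ => exp_mul_sub_one_nonneg hε _
  have hz0 : 0 ≤ ∑ f ∈ U, (Real.exp (ε * s f) - 1) :=
    Finset.sum_nonneg fun f _ => exp_mul_sub_one_nonneg hε _
  have hle : ∑ f ∈ U.filter E, (Real.exp (ε * s' f) - 1) ≤ ∑ f ∈ U, (Real.exp (ε * s' f) - 1) :=
    Finset.sum_le_sum_of_subset_of_nonneg (Finset.filter_subset _ _)
      fun f _ _ => exp_mul_sub_one_nonneg hε _
  unfold selProb
  generalize Real.exp ε = a at *
  generalize ∑ f ∈ U.filter E, (Real.exp (ε * s f) - 1) = x at *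
  generalize ∑ f ∈ U.filter E, (Real.exp (ε * s' f) - 1) = x' at *
  generalize ∑ f ∈ U, (Real.exp (ε * s f) - 1) = z at *
  generalize ∑ f ∈ U, (Real.exp (ε * s' f) - 1) = z' at *
  have hNN : (0 : ℝ) ≤ N := Nat.cast_nonneg N
  have hWz : 0 < W + z := by linarith
  have hWz' : 0 < W + z' := by linarith
  set p' := (W * b + x') / (W + z') with hp'
  have hWb : 0 ≤ W * b := mul_nonneg hW.le hb
  have hp0 : 0 ≤ p' := div_nonneg (by linarith) hWz'.le
  have hp1 : p' ≤ 1 := (div_le_one hWz').mpr (by nlinarith)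
  have hpz : W * b + x' = p' * (W + z') := by rw [hp', div_mul_cancel₀ _ hWz'.ne']
  set d := (a - 1) * N with hd
  have hd0 : 0 ≤ d := mul_nonneg (by linarith) hNN
  have hratio : d / (W + z) ≤ d / W := div_le_div_of_nonneg_left hd0 hW (by linarith)
  calc (W * b + x) / (W + z) ≤ (a * (p' * (W + z')) + d) / (W + z) := by
        refine div_le_div_of_nonneg_right ?_ hWz.le
        rw [← hpz]
        nlinarith
    _ ≤ (a * (p' * (a * (W + z) + d)) + d) / (W + z) := by
        refine div_le_div_of_nonneg_right ?_ hWz.le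
        have : p' * (W + z') ≤ p' * (a * (W + z) + d) :=
          mul_le_mul_of_nonneg_left (by nlinarith) hp0
        nlinarith
    _ = a * a * p' + (a * p' + 1) * (d / (W + z)) := by field_simp; ring
    _ ≤ a * a * p' + (a * 1 + 1) * (d / W) := by gcongr
    _ = Real.exp (2 * ε) * p' + (Real.exp (2 * ε) - 1) * N / W := by
        rw [hsq, hd]; field_simp; ring

end Selection

/-! ### The selection kernel -/

section SelectionKernel

variable {X : Type*} [MeasurableSpace X] {τ L s : ℕ}

/-- The test of `f` against `f'` in block `t`, at level `i`: on the set nearly separating `f` from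
`f'`, the empirical frequency in block `t` is within `i η` of the probability under `f`. -/
def PassesTest (A : ℕ → Set X) (η : ℝ) {T : ℕ} (Y : Fin T → Fin s → X) (t : Fin T) (i : ℕ)
    (f f' : ProbabilityMeasure X) : Prop :=
  |empFreq (Y t) (A (sepIndex A η f f')) - (f : Measure X).real (A (sepIndex A η f f'))| ≤ i * η

/-- The score of `f` for the lists `ω.1` and the test samples `ω.2`. -/
noncomputable def blockScore (A : ℕ → Set X) (η : ℝ)
    (ω : (Fin (10 * τ) → Fin L → ProbabilityMeasure X) × (Fin (10 * τ) → Fin s → X))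
    (f : ProbabilityMeasure X) : ℕ :=
  score (IsListed ω.1) (PassesTest A η ω.2) f

open Classical in
/-- The distributions that occur in some list. -/
noncomputable def candidates {T : ℕ} (H : Fin T → Fin L → ProbabilityMeasure X) :
    Finset (ProbabilityMeasure X) :=
  Finset.univ.image fun p : Fin T × Fin L => H p.1 p.2

lemma mem_candidates {T : ℕ} {H : Fin T → Fin L → ProbabilityMeasure X}
    {f : ProbabilityMeasure X} : f ∈ candidates H ↔ ∃ t, IsListed H t f := by
  simp [candidates, IsListed]

lemma blockScore_eq_zero {A : ℕ → Set X} {η : ℝ}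
    {ω : (Fin (10 * τ) → Fin L → ProbabilityMeasure X) × (Fin (10 * τ) → Fin s → X)}
    {f : ProbabilityMeasure X} (hf : f ∉ candidates ω.1) : blockScore A η ω f = 0 := by
  by_contra h
  have h1 := listCount_of_score_pos (Nat.pos_of_ne_zero h)
  exact hf (mem_candidates.mpr (listCount_pos_iff.mp (by omega)))

/-- The total weight: the fallback has weight `W`, a candidate `f` has weight
`exp (ε * score f) - 1`. -/
noncomputable def totalWeight (A : ℕ → Set X) (η ε W : ℝ)
    (ω : (Fin (10 * τ) → Fin L → ProbabilityMeasure X) × (Fin (10 * τ) → Fin s → X)) : ℝ :=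
  W + ∑ f ∈ candidates ω.1, (Real.exp (ε * blockScore A η ω f) - 1)

/-- Draw a candidate, or the fallback `f₀`, with probability proportional to its weight. -/
noncomputable def selMeasure (A : ℕ → Set X) (η ε W : ℝ) (f₀ : ProbabilityMeasure X)
    (ω : (Fin (10 * τ) → Fin L → ProbabilityMeasure X) × (Fin (10 * τ) → Fin s → X)) :
    Measure (ProbabilityMeasure X) :=
  ENNReal.ofReal (W / totalWeight A η ε W ω) • Measure.dirac f₀ +
    ∑ f ∈ candidates ω.1, ENNReal.ofReal
      ((Real.exp (ε * blockScore A η ω f) - 1) / totalWeight A η ε W ω) • Measure.dirac f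

variable {A : ℕ → Set X} {η ε W : ℝ} {f₀ : ProbabilityMeasure X}

lemma totalWeight_pos (hε : 0 ≤ ε) (hW : 0 < W)
    (ω : (Fin (10 * τ) → Fin L → ProbabilityMeasure X) × (Fin (10 * τ) → Fin s → X)) :
    0 < totalWeight A η ε W ω :=
  add_pos_of_pos_of_nonneg hW (Finset.sum_nonneg fun _ _ => exp_mul_sub_one_nonneg hε _)

lemma selMeasure_apply (hε : 0 ≤ ε) (hW : 0 < W)
    (ω : (Fin (10 * τ) → Fin L → ProbabilityMeasure X) × (Fin (10 * τ) → Fin s → X))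
    {E : Set (ProbabilityMeasure X)} (hE : MeasurableSet E) :
    selMeasure A η ε W f₀ ω E = ENNReal.ofReal
      (selProb ε W (E.indicator 1 f₀) (blockScore A η ω) (candidates ω.1) (· ∈ E)) := by
  classical
  have hZ := totalWeight_pos (A := A) (η := η) hε hW ω
  have hw : ∀ f, 0 ≤ (Real.exp (ε * blockScore A η ω f) - 1) / totalWeight A η ε W ω :=
    fun f => div_nonneg (exp_mul_sub_one_nonneg hε _) hZ.le
  have hind : ∀ (c : ℝ) (f : ProbabilityMeasure X), ENNReal.ofReal c * E.indicator 1 f =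
      ENNReal.ofReal (c * E.indicator 1 f) := by
    intro c f
    by_cases hf : f ∈ E <;> simp [hf]
  have hind0 : ∀ f : ProbabilityMeasure X, 0 ≤ E.indicator (1 : ProbabilityMeasure X → ℝ) f :=
    fun f => Set.indicator_nonneg (fun _ _ => zero_le_one) f
  rw [selMeasure, Measure.add_apply, Measure.smul_apply, Measure.finsetSum_apply]
  simp only [Measure.smul_apply, smul_eq_mul, Measure.dirac_apply' _ hE, hind]
  rw [← ENNReal.ofReal_sum_of_nonneg fun f _ => mul_nonneg (hw f) (hind0 f),
    ← ENNReal.ofReal_add (mul_nonneg (div_pos hW hZ).le (hind0 f₀))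
      (Finset.sum_nonneg fun f _ => mul_nonneg (hw f) (hind0 f))]
  congr 1
  rw [selProb, add_div, Finset.sum_div, Finset.sum_filter]
  congr 1
  · rw [totalWeight]; ring
  · refine Finset.sum_congr rfl fun f _ => ?_
    by_cases hf : f ∈ E <;> simp [hf, totalWeight]

lemma isProbabilityMeasure_selMeasure (hε : 0 ≤ ε) (hW : 0 < W)
    (ω : (Fin (10 * τ) → Fin L → ProbabilityMeasure X) × (Fin (10 * τ) → Fin s → X)) :
    IsProbabilityMeasure (selMeasure A η ε W f₀ ω) := by
  classical
  refine ⟨?_⟩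
  rw [selMeasure_apply hε hW ω MeasurableSet.univ, selProb]
  have hZ := totalWeight_pos (A := A) (η := η) hε hW ω
  rw [totalWeight] at hZ
  simp only [Set.mem_univ, Finset.filter_true]
  rw [Set.indicator_univ, Pi.one_apply, mul_one, div_self hZ.ne', ENNReal.ofReal_one]

/-- Inputs that agree off one block lead to indistinguishable selections. -/
lemma selMeasure_le_of_differ_at (hε : 0 ≤ ε) (hW : 0 < W)
    {ω ω' : (Fin (10 * τ) → Fin L → ProbabilityMeasure X) × (Fin (10 * τ) → Fin s → X)}
    {t₀ : Fin (10 * τ)} (h1 : ∀ t, t ≠ t₀ → ω.1 t = ω'.1 t) (h2 : ∀ t, t ≠ t₀ → ω.2 t = ω'.2 t)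
    {E : Set (ProbabilityMeasure X)} (hE : MeasurableSet E) :
    selMeasure A η ε W f₀ ω E ≤ ENNReal.ofReal (Real.exp (2 * ε)) * selMeasure A η ε W f₀ ω' E +
      ENNReal.ofReal ((Real.exp (2 * ε) - 1) * (4 * L : ℕ) / W) := by
  classical
  -- Enlarging the set of candidates by elements of score zero changes nothing, so both selections
  -- can be regarded as drawn from the union of the two sets of candidates.
  have hext : ∀ (ω : (Fin (10 * τ) → Fin L → ProbabilityMeasure X) × (Fin (10 * τ) → Fin s → X))
      (U : Finset (ProbabilityMeasure X)) (b : ℝ), candidates ω.1 ⊆ U →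
      selProb ε W b (blockScore A η ω) (candidates ω.1) (· ∈ E) =
      selProb ε W b (blockScore A η ω) U (· ∈ E) := by
    intro ω U b hU
    have h0 : ∀ f, f ∉ candidates ω.1 → Real.exp (ε * blockScore A η ω f) - 1 = 0 := by
      intro f hf
      simp [blockScore_eq_zero hf]
    rw [selProb, selProb, Finset.sum_subset hU fun f _ hf => h0 f hf,
      Finset.sum_subset (Finset.filter_subset_filter _ hU) fun f hf hf' => h0 f fun hfc =>
        hf' (Finset.mem_filter.mpr ⟨hfc, (Finset.mem_filter.mp hf).2⟩)]
  have hm : ∀ t, t ≠ t₀ → IsListed ω.1 t = IsListed ω'.1 t := fun t ht => by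
    funext f; simp only [IsListed, h1 t ht]
  have hp : ∀ t, t ≠ t₀ → PassesTest A η ω.2 t = PassesTest A η ω'.2 t := fun t ht => by
    funext i f f'; simp only [PassesTest, h2 t ht]
  rw [selMeasure_apply hε hW ω hE, selMeasure_apply hε hW ω' hE,
    hext ω (candidates ω.1 ∪ candidates ω'.1) _ Finset.subset_union_left,
    hext ω' (candidates ω.1 ∪ candidates ω'.1) _ Finset.subset_union_right,
    ← ENNReal.ofReal_mul (Real.exp_nonneg _)]
  have hb : 0 ≤ E.indicator (1 : ProbabilityMeasure X → ℝ) f₀ :=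
    Set.indicator_nonneg (fun _ _ => zero_le_one) f₀
  have hb' : E.indicator (1 : ProbabilityMeasure X → ℝ) f₀ ≤ 1 :=
    Set.indicator_le_self' (f := (1 : ProbabilityMeasure X → ℝ)) (fun _ _ => zero_le_one) f₀
  refine (ENNReal.ofReal_le_ofReal (selProb_le hε hW hb hb'
    (fun f => score_le_succ_of_differ_at hm hp f)
    (fun f => score_le_succ_of_differ_at (fun t ht => (hm t ht).symm)
      (fun t ht => (hp t ht).symm) f)
    (card_score_pos_le _ _ _) (card_score_pos_le _ _ _) (· ∈ E))).trans ENNReal.ofReal_add_le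

/-! ### Measurability of the selection -/

lemma measurable_card_filter {Ω ι : Type*} [MeasurableSpace Ω] (S : Finset ι) {p : Ω → ι → Prop}
    [∀ ω, DecidablePred (p ω)] (h : ∀ t ∈ S, MeasurableSet {ω | p ω t}) :
    Measurable fun ω => (S.filter (p ω)).card := by
  simp_rw [Finset.card_filter]
  refine Finset.measurable_sum _ fun t ht => ?_
  exact Measurable.ite (h t ht) measurable_const measurable_const

lemma qualifies_iff {H : Fin (10 * τ) → Fin L → ProbabilityMeasure X}
    {pass : Fin (10 * τ) → ℕ → ProbabilityMeasure X → ProbabilityMeasure X → Prop} {i : ℕ}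
    {f : ProbabilityMeasure X} {k : ℕ} :
    Qualifies (IsListed H) pass i f k ↔ k ≤ listCount (IsListed H) f ∧
      ∀ t j, listCount (IsListed H) (H t j) + k ≤ 10 * τ ∨ k ≤ passCount pass i f (H t j) := by
  refine and_congr_right fun hk => ⟨fun h t j => h _, fun h f' => ?_⟩
  rcases Nat.eq_zero_or_pos (listCount (IsListed H) f') with h0 | hpos
  · left
    have := listCount_le (IsListed H) f
    omega
  · obtain ⟨t, j, rfl⟩ := listCount_pos_iff.mp hpos
    exact h t j

lemma stands_iff {H : Fin (10 * τ) → Fin L → ProbabilityMeasure X}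
    {pass : Fin (10 * τ) → ℕ → ProbabilityMeasure X → ProbabilityMeasure X → Prop}
    {f : ProbabilityMeasure X} {k : ℕ} (hk : k < 7 * τ) :
    Stands (IsListed H) pass f k ↔ ∃ i, Qualifies (IsListed H) pass i f (3 * τ + k) ∧
      (i = 0 ∨ ∀ t j, ¬ Qualifies (IsListed H) pass (i - 1) (H t j) (7 * τ - k)) := by
  refine exists_congr fun i => and_congr_right fun _ => or_congr_right
    ⟨fun h t j => h _, fun h f' hf' => ?_⟩
  obtain ⟨t, j, rfl⟩ := listCount_pos_iff.mp (lt_of_lt_of_le (by omega) hf'.1)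
  exact h t j hf'

section

variable {φ ψ : (Fin (10 * τ) → Fin L → ProbabilityMeasure X) × (Fin (10 * τ) → Fin s → X) →
  ProbabilityMeasure X}

lemma measurable_list (t : Fin (10 * τ)) (j : Fin L) :
    Measurable fun ω : (Fin (10 * τ) → Fin L → ProbabilityMeasure X) ×
      (Fin (10 * τ) → Fin s → X) => ω.1 t j := by
  fun_prop

lemma measurable_passCount (hA : ∀ k, MeasurableSet (A k)) (hη : 0 < η) (i : ℕ)
    (hφ : Measurable φ) (hψ : Measurable ψ) :
    Measurable fun ω => passCount (PassesTest A η ω.2) i (φ ω) (ψ ω) := by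
  classical
  refine measurable_card_filter _ fun t _ => ?_
  have : {ω | PassesTest A η ω.2 t i (φ ω) (ψ ω)} = ⋃ k, ({ω | sepIndex A η (φ ω) (ψ ω) = k} ∩
      {ω | |empFreq (ω.2 t) (A k) - (φ ω : Measure X).real (A k)| ≤ i * η}) := by
    ext ω
    simp [PassesTest]
  rw [this]
  refine MeasurableSet.iUnion fun k => MeasurableSet.inter ?_ ?_
  · exact ((measurable_sepIndex hA hη).comp (hφ.prodMk hψ)) (measurableSet_singleton k)
  · refine measurableSet_le (Measurable.abs (Measurable.sub ?_ ?_)) measurable_const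
    · exact (measurable_empFreq (hA k)).comp ((measurable_pi_apply t).comp measurable_snd)
    · exact (measurable_measureReal (hA k)).comp hφ

variable [MeasurableSpace.CountablyGenerated X]

lemma measurable_listCount (hφ : Measurable φ) :
    Measurable fun ω => listCount (IsListed ω.1) (φ ω) := by
  classical
  refine measurable_card_filter _ fun t _ => ?_
  have : {ω : (Fin (10 * τ) → Fin L → ProbabilityMeasure X) × (Fin (10 * τ) → Fin s → X) |
      IsListed ω.1 t (φ ω)} = ⋃ j, {ω | ω.1 t j = φ ω} := by
    ext ω
    simp [IsListed]
  rw [this]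
  exact MeasurableSet.iUnion fun j => measurableSet_eq_probabilityMeasure (measurable_list t j) hφ

lemma measurableSet_qualifies (hA : ∀ k, MeasurableSet (A k)) (hη : 0 < η) (i k : ℕ)
    (hφ : Measurable φ) :
    MeasurableSet {ω | Qualifies (IsListed ω.1) (PassesTest A η ω.2) i (φ ω) k} := by
  have : {ω | Qualifies (IsListed ω.1) (PassesTest A η ω.2) i (φ ω) k} =
      {ω | k ≤ listCount (IsListed ω.1) (φ ω)} ∩
      ⋂ t, ⋂ j, ({ω | listCount (IsListed ω.1) (ω.1 t j) + k ≤ 10 * τ} ∪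
        {ω | k ≤ passCount (PassesTest A η ω.2) i (φ ω) (ω.1 t j)}) := by
    ext ω
    simp [qualifies_iff]
  rw [this]
  refine MeasurableSet.inter (measurableSet_le measurable_const (measurable_listCount hφ))
    (MeasurableSet.iInter fun t => MeasurableSet.iInter fun j => MeasurableSet.union ?_ ?_)
  · exact measurableSet_le ((measurable_listCount (measurable_list t j)).add_const k)
      measurable_const
  · exact measurableSet_le measurable_const
      (measurable_passCount hA hη i hφ (measurable_list t j))

lemma measurable_blockScore (hA : ∀ k, MeasurableSet (A k)) (hη : 0 < η) (hφ : Measurable φ) :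
    Measurable fun ω => blockScore A η ω (φ ω) := by
  classical
  unfold blockScore score
  refine measurable_card_filter _ fun k hk => ?_
  rw [Finset.mem_Icc] at hk
  have : {ω | Stands (IsListed ω.1) (PassesTest A η ω.2) (φ ω) k} =
      ⋃ i, ({ω | Qualifies (IsListed ω.1) (PassesTest A η ω.2) i (φ ω) (3 * τ + k)} ∩
      ({_ω | i = 0} ∪ ⋂ t, ⋂ j, {ω | Qualifies (IsListed ω.1) (PassesTest A η ω.2) (i - 1)
        (ω.1 t j) (7 * τ - k)}ᶜ)) := by
    ext ω
    simp [stands_iff (show k < 7 * τ by omega)]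
  rw [this]
  exact MeasurableSet.iUnion fun i => MeasurableSet.inter
    (measurableSet_qualifies hA hη i _ hφ) (MeasurableSet.union (MeasurableSet.const _)
      (MeasurableSet.iInter fun t => MeasurableSet.iInter fun j =>
        (measurableSet_qualifies hA hη (i - 1) _ (measurable_list t j)).compl))

end

variable [MeasurableSpace.CountablyGenerated X]

/-- A sum over the distinct candidates is a sum over the places of the lists, each term divided by
the number of places at which the same candidate occurs. -/
lemma measurable_sum_candidates (hA : ∀ k, MeasurableSet (A k)) (hη : 0 < η)
    {E : Set (ProbabilityMeasure X)} (hE : MeasurableSet E) [DecidablePred (· ∈ E)] :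
    Measurable fun ω : (Fin (10 * τ) → Fin L → ProbabilityMeasure X) ×
        (Fin (10 * τ) → Fin s → X) =>
      ∑ f ∈ (candidates ω.1).filter (· ∈ E), (Real.exp (ε * blockScore A η ω f) - 1) := by
  classical
  have hrw : ∀ ω : (Fin (10 * τ) → Fin L → ProbabilityMeasure X) × (Fin (10 * τ) → Fin s → X),
      ∑ f ∈ (candidates ω.1).filter (· ∈ E), (Real.exp (ε * blockScore A η ω f) - 1) =
      ∑ p : Fin (10 * τ) × Fin L, if ω.1 p.1 p.2 ∈ E then
        (Real.exp (ε * blockScore A η ω (ω.1 p.1 p.2)) - 1) /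
        ((Finset.univ.filter fun q : Fin (10 * τ) × Fin L =>
          ω.1 q.1 q.2 = ω.1 p.1 p.2).card : ℝ) else 0 := by
    intro ω
    have := Finset.sum_comp (s := (Finset.univ : Finset (Fin (10 * τ) × Fin L)))
      (fun f : ProbabilityMeasure X => if f ∈ E then (Real.exp (ε * blockScore A η ω f) - 1) /
        ((Finset.univ.filter fun q : Fin (10 * τ) × Fin L => ω.1 q.1 q.2 = f).card : ℝ) else 0)
      (fun p => ω.1 p.1 p.2)
    rw [this, Finset.sum_filter]
    refine Finset.sum_congr rfl fun f hf => ?_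
    split_ifs with hfE
    · obtain ⟨p, -, hp⟩ := Finset.mem_image.mp hf
      have hpos : (Finset.univ.filter
          fun q : Fin (10 * τ) × Fin L => ω.1 q.1 q.2 = f).card ≠ 0 :=
        Finset.card_ne_zero_of_mem (Finset.mem_filter.mpr ⟨Finset.mem_univ p, hp⟩)
      rw [nsmul_eq_mul, mul_div_cancel₀]
      exact_mod_cast hpos
    · simp
  simp_rw [hrw]
  refine Finset.measurable_sum _ fun p _ => ?_
  have hp := measurable_list (X := X) (s := s) p.1 p.2
  refine Measurable.ite (hp hE) (Measurable.div ?_ ?_) measurable_const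
  · exact ((measurable_from_top.comp (measurable_blockScore hA hη hp)).const_mul ε).exp.sub_const 1
  · exact measurable_from_top.comp (measurable_card_filter _ fun q _ =>
      measurableSet_eq_probabilityMeasure (measurable_list q.1 q.2) hp)

/-- The selection as a Markov kernel in the lists and the test samples. -/
noncomputable def selKernel (hA : ∀ k, MeasurableSet (A k)) (hη : 0 < η) (hε : 0 ≤ ε) (hW : 0 < W)
    (f₀ : ProbabilityMeasure X) :
    Kernel ((Fin (10 * τ) → Fin L → ProbabilityMeasure X) × (Fin (10 * τ) → Fin s → X))
      (ProbabilityMeasure X) where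
  toFun ω := selMeasure A η ε W f₀ ω
  measurable' := by
    classical
    refine Measure.measurable_of_measurable_coe _ fun E hE => ?_
    simp_rw [selMeasure_apply hε hW _ hE]
    refine Measurable.ennreal_ofReal (Measurable.div (Measurable.const_add ?_ _)
      (Measurable.const_add ?_ _))
    · exact measurable_sum_candidates hA hη hE
    · simpa using measurable_sum_candidates (τ := τ) (L := L) (s := s) (ε := ε) hA hη
        MeasurableSet.univ

instance (hA : ∀ k, MeasurableSet (A k)) (hη : 0 < η) (hε : 0 ≤ ε) (hW : 0 < W) :
    IsMarkovKernel (selKernel (τ := τ) (L := L) (s := s) hA hη hε hW f₀) :=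
  ⟨fun ω => isProbabilityMeasure_selMeasure hε hW ω⟩

end SelectionKernel

/-! ### The learner on blocks: privacy -/

section BlockLearner

open scoped ENNReal

variable {X : Type*} [MeasurableSpace X] [MeasurableSpace.CountablyGenerated X] {τ L m s : ℕ}
  {A : ℕ → Set X} {η ε W : ℝ}

/-- The learner on `10 τ` blocks: the list decoder `κ` turns the first part of each block into a
list, the parts being treated independently, and the selection is run on these lists and the second
parts of the blocks. -/
noncomputable def blockKernel (hA : ∀ k, MeasurableSet (A k)) (hη : 0 < η) (hε : 0 ≤ ε)
    (hW : 0 < W) (f₀ : ProbabilityMeasure X)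
    (κ : Kernel (Fin m → X) (Fin L → ProbabilityMeasure X)) [IsMarkovKernel κ] :
    Kernel ((Fin (10 * τ) → Fin m → X) × (Fin (10 * τ) → Fin s → X)) (ProbabilityMeasure X) :=
  selKernel hA hη hε hW f₀ ∘ₖ
    (piKernel (fun t : Fin (10 * τ) => κ.comap
      (fun d : (Fin (10 * τ) → Fin m → X) × (Fin (10 * τ) → Fin s → X) => d.1 t) (by fun_prop)) ×ₖ
      Kernel.deterministic Prod.snd measurable_snd)

variable (hA : ∀ k, MeasurableSet (A k)) (hη : 0 < η) (hε : 0 ≤ ε) (hW : 0 < W)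
  (f₀ : ProbabilityMeasure X) (κ : Kernel (Fin m → X) (Fin L → ProbabilityMeasure X))
  [IsMarkovKernel κ]

instance : IsMarkovKernel (blockKernel (τ := τ) (s := s) hA hη hε hW f₀ κ) := by
  unfold blockKernel
  infer_instance

lemma blockKernel_apply (d : (Fin (10 * τ) → Fin m → X) × (Fin (10 * τ) → Fin s → X))
    {E : Set (ProbabilityMeasure X)} (hE : MeasurableSet E) :
    blockKernel hA hη hε hW f₀ κ d E = ∫⁻ H, selKernel hA hη hε hW f₀ (H, d.2) E
      ∂(Measure.pi fun t => κ (d.1 t)) := by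
  have hprod : (piKernel (fun t : Fin (10 * τ) => κ.comap
      (fun d : (Fin (10 * τ) → Fin m → X) × (Fin (10 * τ) → Fin s → X) => d.1 t) (by fun_prop)) ×ₖ
      Kernel.deterministic Prod.snd measurable_snd) d =
      (Measure.pi fun t => κ (d.1 t)).map fun H => (H, d.2) := by
    rw [Kernel.prod_apply, Kernel.deterministic_apply, Measure.prod_dirac]
    rfl
  rw [blockKernel, Kernel.comp_apply' _ _ _ hE, hprod,
    lintegral_map (Kernel.measurable_coe _ hE) (by fun_prop)]

lemma blockKernel_le_of_differ_at
    {d d' : (Fin (10 * τ) → Fin m → X) × (Fin (10 * τ) → Fin s → X)}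
    {t₀ : Fin (10 * τ)} (h1 : ∀ t, t ≠ t₀ → d.1 t = d'.1 t) (h2 : ∀ t, t ≠ t₀ → d.2 t = d'.2 t)
    {E : Set (ProbabilityMeasure X)} (hE : MeasurableSet E) :
    blockKernel hA hη hε hW f₀ κ d E ≤
      ENNReal.ofReal (Real.exp (2 * ε)) * blockKernel hA hη hε hW f₀ κ d' E +
        ENNReal.ofReal ((Real.exp (2 * ε) - 1) * (4 * L : ℕ) / W) := by
  rw [blockKernel_apply _ _ _ _ _ _ _ hE, blockKernel_apply _ _ _ _ _ _ _ hE]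
  refine lintegral_pi_le_of_differ_at (fun t => κ (d.1 t)) (fun t => κ (d'.1 t)) t₀
    (fun t ht => by rw [h1 t ht]) ?_ ?_ _ _ fun H H' hHH' =>
      selMeasure_le_of_differ_at hε hW (ω := (H, d.2)) (ω' := (H', d'.2)) hHH' h2 hE
  · exact (Kernel.measurable_coe _ hE).comp (by fun_prop)
  · exact (Kernel.measurable_coe _ hE).comp (by fun_prop)

/-- The blocks read off a dataset along an indexing `e` of the places of the blocks. -/
def readBlocks {N : ℕ} (e : (Fin (10 * τ) × Fin m) ⊕ (Fin (10 * τ) × Fin s) → Fin N)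
    (D : Fin N → X) : (Fin (10 * τ) → Fin m → X) × (Fin (10 * τ) → Fin s → X) :=
  (fun t j => D (e (.inl (t, j))), fun t j => D (e (.inr (t, j))))

omit [MeasurableSpace.CountablyGenerated X] in
lemma measurable_readBlocks {N : ℕ}
    (e : (Fin (10 * τ) × Fin m) ⊕ (Fin (10 * τ) × Fin s) → Fin N) :
    Measurable (readBlocks (X := X) e) := by
  unfold readBlocks
  fun_prop

omit [MeasurableSpace X] [MeasurableSpace.CountablyGenerated X] in
/-- One entry of the dataset enters at most one block. -/
lemma Neighbouring.exists_readBlocks_differ_at {N : ℕ} (hτ : 0 < τ)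
    {e : (Fin (10 * τ) × Fin m) ⊕ (Fin (10 * τ) × Fin s) → Fin N} (he : e.Injective)
    {D D' : Fin N → X} (h : Neighbouring D D') :
    ∃ t₀, (∀ t, t ≠ t₀ → (readBlocks e D).1 t = (readBlocks e D').1 t) ∧
      ∀ t, t ≠ t₀ → (readBlocks e D).2 t = (readBlocks e D').2 t := by
  obtain ⟨i, hi⟩ := h
  have key : ∃ t₀, ∀ t, t ≠ t₀ → (∀ j, e (.inl (t, j)) ≠ i) ∧ ∀ j, e (.inr (t, j)) ≠ i := by
    by_cases hrange : ∃ x, e x = i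
    · obtain ⟨x, rfl⟩ := hrange
      refine ⟨x.elim Prod.fst Prod.fst, fun t ht => ⟨fun j hj => ht ?_, fun j hj => ht ?_⟩⟩ <;>
      · rw [← he hj]; rfl
    · exact ⟨⟨0, by omega⟩, fun t _ => ⟨fun j hj => hrange ⟨_, hj⟩, fun j hj => hrange ⟨_, hj⟩⟩⟩
  obtain ⟨t₀, ht₀⟩ := key
  exact ⟨t₀, fun t ht => funext fun j => hi _ ((ht₀ t ht).1 j),
    fun t ht => funext fun j => hi _ ((ht₀ t ht).2 j)⟩

/-- The learner on datasets of size `N`. -/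
noncomputable def learner {N : ℕ} (e : (Fin (10 * τ) × Fin m) ⊕ (Fin (10 * τ) × Fin s) → Fin N) :
    Kernel (Fin N → X) (ProbabilityMeasure X) :=
  (blockKernel hA hη hε hW f₀ κ).comap (readBlocks e) (measurable_readBlocks e)

instance {N : ℕ} (e : (Fin (10 * τ) × Fin m) ⊕ (Fin (10 * τ) × Fin s) → Fin N) :
    IsMarkovKernel (learner hA hη hε hW f₀ κ e) := by
  unfold learner
  infer_instance

lemma differentiallyPrivate_learner {N : ℕ} (hτ : 0 < τ)
    {e : (Fin (10 * τ) × Fin m) ⊕ (Fin (10 * τ) × Fin s) → Fin N} (he : e.Injective) {ε' δ : ℝ}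
    (hε' : 2 * ε ≤ ε') (hδ : (Real.exp (2 * ε) - 1) * (4 * L : ℕ) / W ≤ δ) :
    DifferentiallyPrivate ε' δ (learner hA hη hε hW f₀ κ e) := by
  have key : ∀ D D' : Fin N → X, Neighbouring D D' → ∀ E, MeasurableSet E →
      learner hA hη hε hW f₀ κ e D E ≤
        ENNReal.ofReal (Real.exp ε') * learner hA hη hε hW f₀ κ e D' E + ENNReal.ofReal δ := by
    intro D D' h E hE
    obtain ⟨t₀, h1, h2⟩ := h.exists_readBlocks_differ_at hτ he
    refine (blockKernel_le_of_differ_at hA hη hε hW f₀ κ h1 h2 hE).trans ?_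
    exact add_le_add (mul_le_mul_left (ENNReal.ofReal_le_ofReal (Real.exp_le_exp.mpr hε')) _)
      (ENNReal.ofReal_le_ofReal hδ)
  refine fun D D' h E hE => ⟨key D D' h E hE, key D' D ?_ E hE⟩
  obtain ⟨i, hi⟩ := h
  exact ⟨i, fun j hj => (hi j hj).symm⟩

/-! ### The learner on blocks: accuracy -/

/-- Some test sample misjudges, by more than `η`, the probability of a set used in a test between
`f₁` and a candidate. -/
def deviating (A : ℕ → Set X) (η : ℝ) (g f₁ : ProbabilityMeasure X)
    (H : Fin (10 * τ) → Fin L → ProbabilityMeasure X) : Set (Fin (10 * τ) → Fin s → X) :=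
  ⋃ p : (Fin (10 * τ) × Fin L) × Fin (10 * τ),
    {Y | η < |empFreq (Y p.2) (A (sepIndex A η f₁ (H p.1.1 p.1.2))) -
      (g : Measure X).real (A (sepIndex A η f₁ (H p.1.1 p.1.2)))|}

omit [MeasurableSpace.CountablyGenerated X] in
lemma measure_deviating_le (hA : ∀ k, MeasurableSet (A k)) (hη : 0 < η) (hs : 0 < s)
    (g f₁ : ProbabilityMeasure X) (H : Fin (10 * τ) → Fin L → ProbabilityMeasure X) :
    (Measure.pi fun _ => Measure.pi fun _ => (g : Measure X))
      (deviating (s := s) A η g f₁ H) ≤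
      ENNReal.ofReal (10 * τ * L * (10 * τ) * (2 * Real.exp (-(2 * s * η ^ 2)))) := by
  refine (measure_iUnion_fintype_le _ _).trans ?_
  calc _ ≤ ∑ _p : (Fin (10 * τ) × Fin L) × Fin (10 * τ),
        ENNReal.ofReal (2 * Real.exp (-(2 * s * η ^ 2))) := by
        refine Finset.sum_le_sum fun p _ => ?_
        have hAk := hA (sepIndex A η f₁ (H p.1.1 p.1.2))
        have hset : MeasurableSet {y : Fin s → X |
            η < |empFreq y (A (sepIndex A η f₁ (H p.1.1 p.1.2))) -
              (g : Measure X).real (A (sepIndex A η f₁ (H p.1.1 p.1.2)))|} :=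
          measurableSet_lt measurable_const ((measurable_empFreq hAk).sub_const _).abs
        have hev := measurePreserving_eval
          (fun _ : Fin (10 * τ) => Measure.pi fun _ : Fin s => (g : Measure X)) p.2
        exact (hev.measure_preimage hset.nullMeasurableSet).trans_le
          (measure_empFreq_dev_le (g : Measure X) hAk hs hη.le)
    _ = _ := by
        rw [Finset.sum_const, nsmul_eq_mul, Finset.card_univ, Fintype.card_prod,
          Fintype.card_prod, Fintype.card_fin, Fintype.card_fin, ← ENNReal.ofReal_natCast,
          ← ENNReal.ofReal_mul (by positivity)]
        push_cast
        rfl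

omit [MeasurableSpace.CountablyGenerated X] in
/-- With `f₁` listed often and no deviating test sample, `f₁` passes all tests from level
`Δ / η + 1` on, so a candidate `f` of positive score passes a test against `f₁` at a level below
`Δ / η + 2` (or at level `0`). On the separating set the probabilities under `f` and
`f₁` then differ by at most `2 Δ + 3 η`, and the set realises their total variation distance up to
`η`. -/
lemma tvDist_le_of_score_pos (hA : IsDetermining A) (hη : 0 < η) {g f₁ : ProbabilityMeasure X}
    {Δ : ℝ} (hΔ : tvDist f₁ g ≤ Δ)
    {ω : (Fin (10 * τ) → Fin L → ProbabilityMeasure X) × (Fin (10 * τ) → Fin s → X)}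
    (hcount : 8 * τ ≤ listCount (IsListed ω.1) f₁) (hdev : ω.2 ∉ deviating A η g f₁ ω.1) :
    (∃ f, blockScore A η ω f = 2 * τ) ∧
      ∀ f, 0 < blockScore A η ω f → tvDist f g ≤ 3 * Δ + 4 * η := by
  have hΔ0 : 0 ≤ Δ := (tvDist_nonneg _ _).trans hΔ
  have hdev' : ∀ f', 0 < listCount (IsListed ω.1) f' → ∀ t,
      |empFreq (ω.2 t) (A (sepIndex A η f₁ f')) - (g : Measure X).real (A (sepIndex A η f₁ f'))|
        ≤ η := by
    intro f' hf' t
    obtain ⟨u, j, rfl⟩ := listCount_pos_iff.mp hf'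
    by_contra! h
    exact hdev (Set.mem_iUnion.mpr ⟨((u, j), t), h⟩)
  have hpass : ∀ i : ℕ, Δ / η + 1 ≤ i → ∀ f', 0 < listCount (IsListed ω.1) f' →
      ∀ t, PassesTest A η ω.2 t i f₁ f' := by
    intro i hi f' hf' t
    have h1 := hdev' f' hf' t
    have h2 := abs_measureReal_sub_le_tvDist f₁ g (hA.1 (sepIndex A η f₁ f'))
    have h3 : Δ + η ≤ i * η := by
      calc Δ + η = (Δ / η + 1) * η := by field_simp
        _ ≤ i * η := by gcongr
    unfold PassesTest
    rw [abs_le] at *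
    constructor <;> linarith
  refine ⟨exists_score_eq hcount hpass, fun f hf => ?_⟩
  obtain ⟨i, hi, t, ht⟩ := exists_pass_of_score_pos hcount hpass hf
  have hiη : i * η ≤ Δ + 2 * η := by
    rcases hi with rfl | hi
    · simp; positivity
    · calc i * η ≤ (Δ / η + 1 + 1) * η := by gcongr
        _ = Δ + 2 * η := by field_simp; ring
  have h1 := hdev' f (by have := listCount_of_score_pos hf; omega) t
  have h2 := abs_measureReal_sub_le_tvDist f₁ g (hA.1 (sepIndex A η f₁ f))
  have h3 : |(f : Measure X).real (A (sepIndex A η f f₁)) -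
      (f₁ : Measure X).real (A (sepIndex A η f f₁))| ≤ 2 * Δ + 3 * η := by
    unfold PassesTest at ht
    rw [sepIndex_comm A η f f₁] at ht ⊢
    rw [abs_le] at *
    constructor <;> linarith
  linarith [tvDist_le_sepIndex hA hη f f₁, tvDist_triangle f f₁ g]

omit [MeasurableSpace.CountablyGenerated X] in
/-- With `f₁` listed often and no deviating test sample, only the fallback can be far from `g`, and
a candidate of full score makes the fallback unlikely. -/
lemma selMeasure_far_le (hA : IsDetermining A) (hη : 0 < η) (hε : 0 ≤ ε) (hW : 1 ≤ W) (hτ : 0 < τ)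
    {f₀ g f₁ : ProbabilityMeasure X} {Δ : ℝ} (hΔ : tvDist f₁ g ≤ Δ)
    {ω : (Fin (10 * τ) → Fin L → ProbabilityMeasure X) × (Fin (10 * τ) → Fin s → X)}
    (hcount : 8 * τ ≤ listCount (IsListed ω.1) f₁) (hdev : ω.2 ∉ deviating A η g f₁ ω.1)
    {E : Set (ProbabilityMeasure X)} (hE : MeasurableSet E)
    (hfar : ∀ f ∈ E, 3 * Δ + 4 * η < tvDist f g) :
    selMeasure A η ε W f₀ ω E ≤ ENNReal.ofReal (W / Real.exp (ε * (2 * τ))) := by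
  classical
  obtain ⟨⟨f, hf⟩, hclose⟩ := tvDist_le_of_score_pos hA hη hΔ hcount hdev
  rw [selMeasure_apply hε (by linarith) ω hE]
  refine ENNReal.ofReal_le_ofReal ?_
  have hfc : f ∈ candidates ω.1 := by
    by_contra h
    have := blockScore_eq_zero (A := A) (η := η) h
    omega
  have hsum : Real.exp (ε * (2 * τ)) - 1 ≤
      ∑ f ∈ candidates ω.1, (Real.exp (ε * blockScore A η ω f) - 1) := by
    have := Finset.single_le_sum (s := candidates ω.1)
      (f := fun f => Real.exp (ε * blockScore A η ω f) - 1)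
      (fun f _ => exp_mul_sub_one_nonneg hε _) hfc
    simpa [hf] using this
  have hzero : ∑ f ∈ (candidates ω.1).filter (· ∈ E),
      (Real.exp (ε * blockScore A η ω f) - 1) = 0 := by
    refine Finset.sum_eq_zero fun f hf => ?_
    have hfE := hfar f (Finset.mem_filter.mp hf).2
    have : blockScore A η ω f = 0 := by
      by_contra h
      exact absurd (hclose f (Nat.pos_of_ne_zero h)) (not_le.mpr hfE)
    simp [this]
  have hb : E.indicator (1 : ProbabilityMeasure X → ℝ) f₀ ≤ 1 :=
    Set.indicator_le_self' (f := (1 : ProbabilityMeasure X → ℝ)) (fun _ _ => zero_le_one) f₀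
  have hb0 : 0 ≤ E.indicator (1 : ProbabilityMeasure X → ℝ) f₀ :=
    Set.indicator_nonneg (fun _ _ => zero_le_one) f₀
  have hexp := Real.exp_pos (ε * (2 * τ))
  rw [selProb, hzero, add_zero]
  exact div_le_div₀ (by linarith) (by nlinarith) hexp (by linarith)

/-- The three ways for the learner to fail: too few lists contain the stable distribution, a test
sample deviates, or the fallback is selected. -/
lemma outputLaw_learner_far_le (hA : IsDetermining A) (hW1 : 1 ≤ W) (hτ : 0 < τ) (hs : 0 < s)
    {N : ℕ} {e : (Fin (10 * τ) × Fin m) ⊕ (Fin (10 * τ) × Fin s) → Fin N} (he : e.Injective)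
    {g f₁ : ProbabilityMeasure X}
    (hstable : ENNReal.ofReal 0.91 ≤ outputLaw κ g {H | ∃ j, H j = f₁})
    {Δ : ℝ} (hΔ : tvDist f₁ g ≤ Δ) {E : Set (ProbabilityMeasure X)} (hE : MeasurableSet E)
    (hfar : ∀ f ∈ E, 3 * Δ + 4 * η < tvDist f g) :
    outputLaw (learner hA.1 hη hε hW f₀ κ e) g E ≤
      ENNReal.ofReal (Real.exp (-(τ / 2 : ℝ))) +
      ENNReal.ofReal (10 * τ * L * (10 * τ) * (2 * Real.exp (-(2 * s * η ^ 2)))) +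
      ENNReal.ofReal (W / Real.exp (ε * (2 * τ))) := by
  classical
  set B : Set (Fin L → ProbabilityMeasure X) := {h | ∃ j, h j = f₁} with hB
  have hBm : MeasurableSet B := by
    have : B = ⋃ j, {h | h j = f₁} := by ext h; simp [hB]
    rw [this]
    exact MeasurableSet.iUnion fun j =>
      measurableSet_eq_probabilityMeasure (measurable_pi_apply j) measurable_const
  set few : Set (Fin (10 * τ) → Fin L → ProbabilityMeasure X) :=
    {H | listCount (IsListed H) f₁ < 8 * τ}
  set P₁ : Measure (Fin m → X) := Measure.pi fun _ => (g : Measure X) with hP₁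
  set P₂ : Measure (Fin (10 * τ) → Fin s → X) :=
    Measure.pi fun _ => Measure.pi fun _ => (g : Measure X) with hP₂
  set c₂ := ENNReal.ofReal (10 * τ * L * (10 * τ) * (2 * Real.exp (-(2 * s * η ^ 2)))) with hc₂
  set c₃ := ENNReal.ofReal (W / Real.exp (ε * (2 * τ))) with hc₃
  have hpoint : ∀ H (Y : Fin (10 * τ) → Fin s → X), selKernel hA.1 hη hε hW f₀ (H, Y) E ≤
      few.indicator 1 H + ((deviating A η g f₁ H).indicator 1 Y + c₃) := by
    intro H Y
    by_cases hH : H ∈ few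
    · have h1 : selKernel hA.1 hη hε hW f₀ (H, Y) E ≤ 1 := prob_le_one
      rw [Set.indicator_of_mem hH, Pi.one_apply]
      exact h1.trans le_self_add
    by_cases hY : Y ∈ deviating A η g f₁ H
    · have h1 : selKernel hA.1 hη hε hW f₀ (H, Y) E ≤ 1 := prob_le_one
      rw [Set.indicator_of_mem hY, Pi.one_apply]
      exact h1.trans (le_self_add.trans le_add_self)
    have hcount : 8 * τ ≤ listCount (IsListed H) f₁ := not_lt.mp hH
    have hsel : selMeasure A η ε W f₀ (H, Y) E ≤ c₃ :=
      selMeasure_far_le (ω := (H, Y)) hA hη hε hW1 hτ hΔ hcount hY hE hfar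
    exact le_trans hsel (le_add_self.trans le_add_self)
  have hY : ∀ H, ∫⁻ Y, selKernel hA.1 hη hε hW f₀ (H, Y) E ∂P₂ ≤
      few.indicator 1 H + (c₂ + c₃) := by
    intro H
    calc _ ≤ ∫⁻ Y, (few.indicator 1 H + ((deviating A η g f₁ H).indicator 1 Y + c₃)) ∂P₂ :=
          lintegral_mono fun Y => hpoint H Y
      _ = few.indicator 1 H + (∫⁻ Y, (deviating A η g f₁ H).indicator 1 Y ∂P₂ + c₃) := by
          rw [lintegral_add_left measurable_const, lintegral_add_right _ measurable_const]
          simp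
      _ ≤ _ := by
          gcongr
          exact (lintegral_indicator_one_le _).trans (measure_deviating_le hA.1 hη hs g f₁ H)
  have hD : ∀ D₁ : Fin (10 * τ) → Fin m → X,
      ∫⁻ Y, blockKernel hA.1 hη hε hW f₀ κ (D₁, Y) E ∂P₂ ≤
      (Measure.pi fun t => κ (D₁ t)) few + (c₂ + c₃) := by
    intro D₁
    simp_rw [blockKernel_apply hA.1 hη hε hW f₀ κ _ hE]
    rw [lintegral_lintegral_swap (f := fun Y H => selKernel hA.1 hη hε hW f₀ (H, Y) E)
      ((Kernel.measurable_coe _ hE).comp (measurable_snd.prodMk measurable_fst)).aemeasurable]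
    calc _ ≤ ∫⁻ H, (few.indicator 1 H + (c₂ + c₃)) ∂(Measure.pi fun t => κ (D₁ t)) :=
          lintegral_mono fun H => hY H
      _ = ∫⁻ H, few.indicator 1 H ∂(Measure.pi fun t => κ (D₁ t)) + (c₂ + c₃) := by
          rw [lintegral_add_right _ measurable_const]
          simp
      _ ≤ _ := by
          gcongr
          exact lintegral_indicator_one_le _
  have hlaw : outputLaw (learner hA.1 hη hε hW f₀ κ e) g E =
      ∫⁻ D₁, ∫⁻ Y, blockKernel hA.1 hη hε hW f₀ κ (D₁, Y) E ∂P₂ ∂(Measure.pi fun _ => P₁) := by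
    rw [outputLaw, Measure.bind_apply hE (Kernel.aemeasurable _),
      ← lintegral_prod (fun p => blockKernel hA.1 hη hε hW f₀ κ p E)
        (Kernel.measurable_coe _ hE).aemeasurable]
    exact (measurePreserving_blocks (g : Measure X) he).lintegral_comp
      (Kernel.measurable_coe (blockKernel hA.1 hη hε hW f₀ κ) hE)
  rw [hlaw]
  calc _ ≤ ∫⁻ D₁, ((Measure.pi fun t => κ (D₁ t)) few + (c₂ + c₃)) ∂(Measure.pi fun _ => P₁) :=
        lintegral_mono hD
    _ = ∫⁻ D₁, (Measure.pi fun t => κ (D₁ t)) few ∂(Measure.pi fun _ => P₁) + (c₂ + c₃) := by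
        rw [lintegral_add_right _ measurable_const]
        simp
    _ ≤ ENNReal.ofReal (Real.exp (-(τ / 2 : ℝ))) + (c₂ + c₃) := by
        gcongr
        refine (lintegral_mono fun D₁ => measure_mono fun H hH => ?_).trans
          (lintegral_pi_few_successes_le P₁ κ hBm hstable τ)
        refine lt_of_le_of_lt (le_of_eq ?_) (show listCount (IsListed H) f₁ < 8 * τ from hH)
        unfold listCount
        congr 1
    _ = _ := (add_assoc _ _ _).symm

end BlockLearner

/-! ### Lists of length one -/

section SingletonLists

open scoped ENNReal

/-- Domination `a • μ ≤ ν` passes to powers; the factors are exchanged one at a time. -/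
lemma pow_smul_pi_le {X ι : Type*} [Fintype ι] [MeasurableSpace X] {μ ν : Measure X}
    [IsProbabilityMeasure μ] [IsProbabilityMeasure ν] {a : ℝ≥0∞} (h : a • μ ≤ ν) {E : Set (ι → X)}
    (hE : MeasurableSet E) :
    a ^ Fintype.card ι * (Measure.pi fun _ : ι => μ) E ≤ (Measure.pi fun _ : ι => ν) E := by
  classical
  let θ : Finset ι → ι → Measure X := fun S i => if i ∈ S then ν else μ
  have hθ : ∀ S i, IsProbabilityMeasure (θ S i) := fun S i => by
    simp only [θ]; split_ifs <;> infer_instance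
  have key : ∀ S : Finset ι, a ^ S.card * (Measure.pi fun _ : ι => μ) E ≤ (Measure.pi (θ S)) E := by
    intro S
    induction S using Finset.induction_on with
    | empty => simp [θ]
    | insert i S hi ih =>
      have hup := map_update_pi (θ S) (θ S) i fun _ _ => rfl
      have hup' := map_update_pi (θ S) (θ (insert i S)) i fun j hj => by simp [θ, hj]
      have hSi : θ S i = μ := by simp [θ, hi]
      have hSi' : θ (insert i S) i = ν := by simp [θ]
      rw [hSi] at hup
      rw [hSi'] at hup'
      rw [Finset.card_insert_of_notMem hi, pow_succ', mul_assoc]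
      refine (mul_le_mul_right ih a).trans ?_
      rw [← hup.measure_preimage hE.nullMeasurableSet,
        ← hup'.measure_preimage hE.nullMeasurableSet,
        Measure.prod_apply (hup.measurable hE), Measure.prod_apply (hup.measurable hE),
        ← lintegral_const_mul _ (measurable_measure_prodMk_left (hup.measurable hE))]
      exact lintegral_mono fun H => h _
  have := key Finset.univ
  simpa [θ] using this

lemma pow_mul_outputLaw_le {X Y : Type*} [MeasurableSpace X] [MeasurableSpace Y] {m : ℕ}
    (κ : Kernel (Fin m → X) Y) {g h : ProbabilityMeasure X} {a : ℝ≥0∞}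
    (hgh : a • (g : Measure X) ≤ h) {E : Set Y} (hE : MeasurableSet E) :
    a ^ m * outputLaw κ g E ≤ outputLaw κ h E := by
  have hle : a ^ m • (Measure.pi fun _ : Fin m => (g : Measure X)) ≤
      Measure.pi fun _ : Fin m => (h : Measure X) := by
    refine Measure.le_iff.mpr fun S hS => ?_
    simpa using pow_smul_pi_le (ι := Fin m) hgh hS
  rw [outputLaw, outputLaw, Measure.bind_apply hE κ.aemeasurable,
    Measure.bind_apply hE κ.aemeasurable, ← smul_eq_mul, ← lintegral_smul_measure]
  exact lintegral_mono' hle le_rfl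

variable {X : Type*} [MeasurableSpace X]

/-- The mixture `w g + (1 - w) h`. -/
noncomputable def mixture (g h : ProbabilityMeasure X) (w : ℝ) (h0 : 0 ≤ w) (h1 : w ≤ 1) :
    ProbabilityMeasure X :=
  ⟨ENNReal.ofReal w • (g : Measure X) + ENNReal.ofReal (1 - w) • (h : Measure X), ⟨by
    rw [Measure.add_apply, Measure.smul_apply, Measure.smul_apply, measure_univ, measure_univ,
      smul_eq_mul, smul_eq_mul, mul_one, mul_one, ← ENNReal.ofReal_add h0 (by linarith)]
    simp⟩⟩

lemma coe_mixture (g h : ProbabilityMeasure X) {w : ℝ} (h0 : 0 ≤ w) (h1 : w ≤ 1) :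
    (mixture g h w h0 h1 : Measure X) =
      ENNReal.ofReal w • (g : Measure X) + ENNReal.ofReal (1 - w) • (h : Measure X) := rfl

/-- With lists of length one, the stable distribution is the same for all sources: it does not
change between sources `g` and `h` with `a • g ≤ h` for `a` close to one, and any two sources are
joined by a finite chain of such pairs, consisting of their mixtures. -/
lemma stable_eq_of_singleton_lists [MeasurableSpace.CountablyGenerated X] {m : ℕ}
    (κ : Kernel (Fin m → X) (Fin 1 → ProbabilityMeasure X)) [IsMarkovKernel κ]
    {G : ProbabilityMeasure X → ProbabilityMeasure X}
    (hG : ∀ g, ENNReal.ofReal 0.91 ≤ outputLaw κ g {H | ∃ j, H j = G g})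
    (g h : ProbabilityMeasure X) : G g = G h := by
  obtain ⟨a, ha0, ha1, ham⟩ : ∃ a : ℝ, 0 < a ∧ a < 1 ∧ 1 / 2 ≤ a ^ m := by
    have hm : (0 : ℝ) < m + 1 := by positivity
    have hle : 1 / (2 * ((m : ℝ) + 1)) ≤ 1 / 2 := by
      apply one_div_le_one_div_of_le <;> linarith [Nat.cast_nonneg (α := ℝ) m]
    have hpos : 0 < 1 / (2 * ((m : ℝ) + 1)) := by positivity
    refine ⟨1 + -(1 / (2 * (m + 1))), by linarith, by linarith, ?_⟩
    refine le_trans ?_ (one_add_mul_le_pow (by linarith) m)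
    have : (m : ℝ) * (1 / (2 * (m + 1))) ≤ 1 / 2 := by
      rw [mul_one_div, div_le_div_iff₀ (by positivity) (by norm_num)]
      linarith
    linarith
  have hstep : ∀ g h : ProbabilityMeasure X, ENNReal.ofReal a • (g : Measure X) ≤ h →
      G g = G h := by
    intro g h hgh
    by_contra hne
    have hmeas : ∀ f : ProbabilityMeasure X,
        MeasurableSet {H : Fin 1 → ProbabilityMeasure X | ∃ j, H j = f} := by
      intro f
      have : {H : Fin 1 → ProbabilityMeasure X | ∃ j, H j = f} = ⋃ j, {H | H j = f} := by
        ext H; simp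
      rw [this]
      exact MeasurableSet.iUnion fun j =>
        measurableSet_eq_probabilityMeasure (measurable_pi_apply j) measurable_const
    have hdisj : Disjoint {H : Fin 1 → ProbabilityMeasure X | ∃ j, H j = G g}
        {H | ∃ j, H j = G h} := by
      rw [Set.disjoint_left]
      rintro H ⟨j, hj⟩ ⟨j', hj'⟩
      rw [Subsingleton.elim j' j] at hj'
      exact hne (hj.symm.trans hj')
    have hlow : ENNReal.ofReal (1 / 2 * 0.91) ≤ outputLaw κ h {H | ∃ j, H j = G g} := by
      refine le_trans ?_ (pow_mul_outputLaw_le κ hgh (hmeas (G g)))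
      rw [ENNReal.ofReal_mul (by norm_num), ← ENNReal.ofReal_pow ha0.le]
      exact mul_le_mul' (ENNReal.ofReal_le_ofReal ham) (hG g)
    have hprob : IsProbabilityMeasure (outputLaw κ h) := by
      unfold outputLaw
      infer_instance
    have hsum := measure_union (μ := outputLaw κ h) hdisj (hmeas (G h))
    have h1 : outputLaw κ h ({H | ∃ j, H j = G g} ∪ {H | ∃ j, H j = G h}) ≤ 1 := prob_le_one
    rw [hsum] at h1
    have h2 := (add_le_add hlow (hG h)).trans h1
    rw [← ENNReal.ofReal_add (by norm_num) (by norm_num), ← ENNReal.ofReal_one,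
      ENNReal.ofReal_le_ofReal_iff (by norm_num)] at h2
    norm_num at h2
  have hw0 : ∀ i : ℕ, 0 ≤ a ^ i := fun i => pow_nonneg ha0.le i
  have hw1 : ∀ i : ℕ, a ^ i ≤ 1 := fun i => pow_le_one₀ ha0.le ha1.le
  have hchain : ∀ i : ℕ, G (mixture g h (a ^ i) (hw0 i) (hw1 i)) = G g := by
    intro i
    induction i with
    | zero =>
      congr 1
      apply Subtype.ext
      change (mixture g h (a ^ 0) (hw0 0) (hw1 0) : Measure X) = (g : Measure X)
      simp [coe_mixture]
    | succ i ih =>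
      rw [← ih]
      refine (hstep _ _ ?_).symm
      rw [coe_mixture, coe_mixture, smul_add, smul_smul, smul_smul, ← ENNReal.ofReal_mul ha0.le,
        ← ENNReal.ofReal_mul ha0.le]
      refine add_le_add (le_of_eq (by rw [pow_succ'])) (Measure.le_iff.mpr fun S _ => ?_)
      rw [Measure.smul_apply, Measure.smul_apply]
      refine mul_le_mul_left (ENNReal.ofReal_le_ofReal ?_) _
      rw [pow_succ']
      linarith
  obtain ⟨n, hn⟩ := exists_pow_lt_of_lt_one (sub_pos.mpr ha1) ha1
  rw [← hchain n]
  refine (hstep _ _ ?_).symm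
  rw [coe_mixture]
  refine Measure.le_iff.mpr fun S _ => ?_
  rw [Measure.add_apply, Measure.smul_apply, Measure.smul_apply]
  exact (mul_le_mul_left (ENNReal.ofReal_le_ofReal (by linarith)) _).trans le_add_self

end SingletonLists

/-! ### Sample size -/

section SampleSize

lemma log_two_le_log_div {L : ℕ} (hL : 2 ≤ L) {b : ℝ} (hb : 0 < b) (hb1 : b ≤ 1) :
    Real.log 2 ≤ Real.log (L / b) := by
  refine Real.log_le_log (by norm_num) ?_
  rw [le_div_iff₀ hb]
  have : (2 : ℝ) ≤ L := by exact_mod_cast hL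
  linarith

lemma sampleRate_nonneg {ε δ α β : ℝ} {m L : ℕ} (hL : 1 ≤ L) (hε : 0 < ε) (hδ : 0 < δ)
    (hδ1 : δ < 1) (hβ : 0 < β) (hβ1 : β < 1) : 0 ≤ sampleRate ε δ α β m L := by
  have hL' : (1 : ℝ) ≤ L := by exact_mod_cast hL
  have h1 : 0 ≤ Real.log (L / (δ * β)) :=
    Real.log_nonneg ((one_le_div (mul_pos hδ hβ)).mpr (by nlinarith))
  have h2 : 0 ≤ Real.log (L / β) := Real.log_nonneg ((one_le_div hβ).mpr (by linarith))
  have h3 : 0 < min ε 1 := lt_min hε one_pos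
  unfold sampleRate
  positivity

/-- The number of blocks, divided by ten. It is chosen so that `exp (τ min(ε, 1))` is at least the
sixth power of `L / (δ β)`, which is at least two: the extra powers absorb the constants in the
probability of the fallback and in Chernoff's bound. -/
noncomputable def blockParam (ε δ β : ℝ) (L : ℕ) : ℕ :=
  ⌈6 * Real.log (L / (δ * β)) / min ε 1⌉₊

/-- The number of samples in a block reserved for the tests. With `η = α / 7`, Hoeffding's
inequality and a union bound over `10 τ L` candidates and `10 τ` blocks leave a failure probability
of `200 L τ ^ 2 exp (-2 s η ^ 2)`; the choice makes this at most `β / 3`. -/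
noncomputable def testSize (ε δ α β : ℝ) (L : ℕ) : ℕ :=
  ⌈Real.log (600 * L * (blockParam ε δ β L : ℝ) ^ 2 / β) * (49 / (2 * α ^ 2))⌉₊

variable {ε δ α β : ℝ} {m L : ℕ}

lemma le_blockParam_mul (hε : 0 < ε) :
    6 * Real.log (L / (δ * β)) ≤ blockParam ε δ β L * min ε 1 := by
  have h3 : 0 < min ε 1 := lt_min hε one_pos
  have := Nat.le_ceil (6 * Real.log (L / (δ * β)) / min ε 1)
  rwa [div_le_iff₀ h3] at this

lemma blockParam_pos (hL : 2 ≤ L) (hε : 0 < ε) (hδ : 0 < δ) (hδ1 : δ < 1) (hβ : 0 < β)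
    (hβ1 : β < 1) : 0 < blockParam ε δ β L := by
  have h1 := log_two_le_log_div hL (mul_pos hδ hβ) (by nlinarith)
  have h2 : 0 < Real.log 2 := Real.log_pos (by norm_num)
  have h3 : 0 < min ε 1 := lt_min hε one_pos
  exact Nat.ceil_pos.mpr (div_pos (by linarith) h3)

lemma blockParam_le (hL : 2 ≤ L) (hε : 0 < ε) (hδ : 0 < δ) (hδ1 : δ < 1) (hβ : 0 < β)
    (hβ1 : β < 1) : (blockParam ε δ β L : ℝ) ≤ 8 * (Real.log (L / (δ * β)) / min ε 1) := by
  have h1 := log_two_le_log_div hL (mul_pos hδ hβ) (by nlinarith)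
  have h2 := Real.log_two_gt_d9
  have h3 : 0 < min ε 1 := lt_min hε one_pos
  have h4 : Real.log (L / (δ * β)) ≤ Real.log (L / (δ * β)) / min ε 1 := by
    rw [le_div_iff₀ h3]
    have : min ε 1 ≤ 1 := min_le_right _ _
    nlinarith
  have h5 : 0 ≤ 6 * Real.log (L / (δ * β)) / min ε 1 := div_nonneg (by linarith) h3.le
  have h6 := (Nat.ceil_lt_add_one h5).le
  rw [mul_div_assoc] at h6
  unfold blockParam
  rw [mul_div_assoc]
  linarith

/-- The number of samples used is within the claimed bound, with a single logarithmic factor, which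
comes from the union bound over the blocks in the choice of `testSize`. -/
lemma sampleSize_le (hL : 2 ≤ L) (hε : 0 < ε) (hδ : 0 < δ) (hδ1 : δ < 1) (hα : 0 < α) (hα1 : α < 1)
    (hβ : 0 < β) (hβ1 : β < 1) :
    ((10 * blockParam ε δ β L * (m + testSize ε δ α β L) : ℕ) : ℝ) ≤
      64000 * sampleRate ε δ α β m L * Real.log (2 + sampleRate ε δ α β m L) := by
  have hL' : (2 : ℝ) ≤ L := by exact_mod_cast hL
  have hτ := blockParam_le hL hε hδ hδ1 hβ hβ1
  have hτ0 : (1 : ℝ) ≤ blockParam ε δ β L := by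
    exact_mod_cast blockParam_pos hL hε hδ hδ1 hβ hβ1
  have hℓ := log_two_le_log_div hL hβ hβ1.le
  have hΛ := log_two_le_log_div hL (mul_pos hδ hβ) (by nlinarith)
  have hlog2 := Real.log_two_gt_d9
  have h3 : 0 < min ε 1 := lt_min hε one_pos
  have hΦ0 : 0 ≤ sampleRate ε δ α β m L := sampleRate_nonneg (by omega) hε hδ hδ1 hβ hβ1
  set τ : ℝ := (blockParam ε δ β L : ℝ) with hτdef
  set q := Real.log (L / (δ * β)) / min ε 1 with hq
  set ℓ := Real.log (L / β) with hℓdef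
  set Φ := sampleRate ε δ α β m L with hΦdef
  have hΦ : Φ = q * (m + ℓ / α ^ 2) := rfl
  set u := Real.log (2 + Φ) with hu
  have hu2 : Real.log 2 ≤ u := Real.log_le_log (by norm_num) (by linarith)
  have hα2 : 0 < α ^ 2 := by positivity
  have hα2' : α ^ 2 ≤ 1 := by nlinarith
  have hq0 : 0 ≤ q := div_nonneg (by linarith) h3.le
  have hℓα : ℓ ≤ ℓ / α ^ 2 := by
    rw [le_div_iff₀ hα2]
    nlinarith
  have hm0 : (0 : ℝ) ≤ m := Nat.cast_nonneg m
  have hlogτ : Real.log τ ≤ 5 * u := by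
    have h1 : τ ≤ (2 + Φ) ^ 5 := by
      have h4 : (0.69 : ℝ) * q ≤ Φ := by
        rw [hΦ, mul_comm]
        exact mul_le_mul_of_nonneg_left (by linarith) hq0
      have h5 : (2 : ℝ) ^ 4 ≤ (2 + Φ) ^ 4 := pow_le_pow_left₀ (by norm_num) (by linarith) 4
      calc τ ≤ 2 ^ 4 * (2 + Φ) := by linarith
        _ ≤ (2 + Φ) ^ 4 * (2 + Φ) := by gcongr
        _ = (2 + Φ) ^ 5 := by ring
    calc Real.log τ ≤ Real.log ((2 + Φ) ^ 5) := Real.log_le_log (by linarith) h1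
      _ = 5 * u := by rw [Real.log_pow]; norm_num [hu]
  have hlog600 : Real.log 600 ≤ 10 * u := by
    calc Real.log 600 ≤ Real.log (2 ^ 10) := Real.log_le_log (by norm_num) (by norm_num)
      _ = 10 * Real.log 2 := by rw [Real.log_pow]; norm_num
      _ ≤ 10 * u := by linarith
  have hlogall : Real.log (600 * L * τ ^ 2 / β) ≤ ℓ + 20 * u := by
    have : 600 * L * τ ^ 2 / β = 600 * (L / β) * τ ^ 2 := by ring
    rw [this, Real.log_mul (by positivity) (by positivity),
      Real.log_mul (by norm_num) (by positivity), Real.log_pow]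
    push_cast
    linarith
  have hlogall0 : 0 ≤ Real.log (600 * L * τ ^ 2 / β) := by
    refine Real.log_nonneg ((one_le_div hβ).mpr ?_)
    nlinarith [sq_nonneg τ]
  have hs : (testSize ε δ α β L : ℝ) ≤ 800 * (ℓ / α ^ 2) * u := by
    have h6 : (testSize ε δ α β L : ℝ) ≤
        Real.log (600 * L * τ ^ 2 / β) * (49 / (2 * α ^ 2)) + 1 :=
      (Nat.ceil_lt_add_one (mul_nonneg hlogall0 (by positivity))).le
    have h7 : Real.log (600 * L * τ ^ 2 / β) * (49 / (2 * α ^ 2)) + 1 ≤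
        (24.5 * (ℓ + 20 * u) + 1) / α ^ 2 := by
      have h8 : (1 : ℝ) ≤ 1 / α ^ 2 := (one_le_div hα2).mpr hα2'
      have h9 : Real.log (600 * L * τ ^ 2 / β) * (49 / (2 * α ^ 2)) =
          24.5 * Real.log (600 * L * τ ^ 2 / β) / α ^ 2 := by field_simp; ring
      rw [h9, add_div]
      gcongr
    have h10 : 24.5 * (ℓ + 20 * u) + 1 ≤ 800 * ℓ * u := by nlinarith
    calc (testSize ε δ α β L : ℝ) ≤ (24.5 * (ℓ + 20 * u) + 1) / α ^ 2 := h6.trans h7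
      _ ≤ 800 * ℓ * u / α ^ 2 := by gcongr
      _ = 800 * (ℓ / α ^ 2) * u := by ring
  have hm : (m : ℝ) ≤ 800 * m * u := by nlinarith
  push_cast
  calc 10 * τ * (m + testSize ε δ α β L)
      ≤ 10 * (8 * q) * (800 * m * u + 800 * (ℓ / α ^ 2) * u) := by gcongr
    _ = 64000 * Φ * u := by rw [hΦ]; ring

lemma testSize_pos (hL : 2 ≤ L) (hε : 0 < ε) (hδ : 0 < δ) (hδ1 : δ < 1) (hα : 0 < α)
    (hβ : 0 < β) (hβ1 : β < 1) : 0 < testSize ε δ α β L := by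
  have hL' : (2 : ℝ) ≤ L := by exact_mod_cast hL
  have hτ0 : (1 : ℝ) ≤ blockParam ε δ β L := by
    exact_mod_cast blockParam_pos hL hε hδ hδ1 hβ hβ1
  refine Nat.ceil_pos.mpr (mul_pos (Real.log_pos ((one_lt_div hβ).mpr ?_)) (by positivity))
  nlinarith

/-- The three failure probabilities are at most `β / 3` each. -/
lemma failure_bounds (hL : 2 ≤ L) (hε : 0 < ε) (hδ : 0 < δ) (hδ1 : δ < 1) (hα : 0 < α)
    (hβ : 0 < β) (hβ1 : β < 1) {τ s : ℕ} (hτ : τ = blockParam ε δ β L)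
    (hs : s = testSize ε δ α β L) :
    Real.exp (-(τ / 2 : ℝ)) ≤ β / 3 ∧
    10 * τ * L * (10 * τ) * (2 * Real.exp (-(2 * s * (α / 7) ^ 2))) ≤ β / 3 ∧
    8 * L / δ / Real.exp (min ε 1 / 2 * (2 * τ)) ≤ β / 3 := by
  have hL' : (2 : ℝ) ≤ L := by exact_mod_cast hL
  have hτ0 : (1 : ℝ) ≤ τ := by
    rw [hτ]; exact_mod_cast blockParam_pos hL hε hδ hδ1 hβ hβ1
  have hτε : 6 * Real.log (L / (δ * β)) ≤ τ * min ε 1 := hτ ▸ le_blockParam_mul hε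
  have hmin : min ε 1 ≤ 1 := min_le_right _ _
  have hδβ : 0 < δ * β := mul_pos hδ hβ
  set r : ℝ := L / (δ * β) with hr
  have hrβ : 2 ≤ r * β := by
    rw [hr, div_mul_eq_mul_div, le_div_iff₀ hδβ]
    nlinarith
  have hr2 : 2 ≤ r := by nlinarith
  have hr0 : 0 < r := by linarith
  refine ⟨?_, ?_, ?_⟩
  · have h1 : r ^ 3 ≤ Real.exp (τ / 2) := by
      calc r ^ 3 = Real.exp (3 * Real.log r) := by
            rw [← Real.log_rpow hr0, Real.exp_log (by positivity)]; norm_cast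
        _ ≤ Real.exp (τ / 2) := Real.exp_le_exp.mpr (by nlinarith)
    rw [Real.exp_neg, inv_le_comm₀ (Real.exp_pos _) (by positivity)]
    refine le_trans ?_ h1
    rw [inv_div, div_le_iff₀ hβ]
    have : 4 ≤ r ^ 2 := by nlinarith
    calc (3 : ℝ) ≤ 4 * 2 := by norm_num
      _ ≤ r ^ 2 * (r * β) := by gcongr
      _ = r ^ 3 * β := by ring
  · set z : ℝ := 600 * L * (τ : ℝ) ^ 2 / β with hz
    have hz0 : 0 < z := by positivity
    have h1 : Real.log z ≤ 2 * s * (α / 7) ^ 2 := by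
      have h2 : Real.log z * (49 / (2 * α ^ 2)) ≤ s := by
        rw [hs, hz, hτ]; exact Nat.le_ceil _
      calc Real.log z = 2 * (Real.log z * (49 / (2 * α ^ 2))) * (α / 7) ^ 2 := by
            field_simp; norm_num
        _ ≤ 2 * s * (α / 7) ^ 2 := by gcongr
    have h3 : Real.exp (-(2 * s * (α / 7) ^ 2)) ≤ z⁻¹ := by
      rw [← Real.exp_log (inv_pos.mpr hz0), Real.log_inv]
      exact Real.exp_le_exp.mpr (neg_le_neg h1)
    calc 10 * τ * L * (10 * τ) * (2 * Real.exp (-(2 * s * (α / 7) ^ 2)))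
        ≤ 10 * τ * L * (10 * τ) * (2 * z⁻¹) := by gcongr
      _ = β / 3 := by rw [hz]; field_simp; norm_num
  · have h1 : r ^ 6 ≤ Real.exp (min ε 1 / 2 * (2 * τ)) := by
      calc r ^ 6 = Real.exp (6 * Real.log r) := by
            rw [← Real.log_rpow hr0, Real.exp_log (by positivity)]; norm_cast
        _ ≤ Real.exp (min ε 1 / 2 * (2 * τ)) := Real.exp_le_exp.mpr (by linarith)
    rw [div_le_iff₀ (Real.exp_pos _)]
    have h2 : (2 : ℝ) ^ 5 ≤ r ^ 5 := pow_le_pow_left₀ (by norm_num) hr2 5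
    have h3 : 8 * L / δ = 8 * (r * β) := by rw [hr]; field_simp
    calc 8 * L / δ = 8 * (r * β) := h3
      _ ≤ β / 3 * (r ^ 5 * r) := by nlinarith [mul_pos hr0 hβ]
      _ = β / 3 * r ^ 6 := by ring
      _ ≤ _ := by gcongr

end SampleSize

/-! ### Stable list decoding gives private agnostic learning -/

section Conclusion

variable {X : Type*} [MeasurableSpace X] [MeasurableSpace.CountablyGenerated X]
  {F : Set (ProbabilityMeasure X)} {m L : ℕ} {C ε δ α β : ℝ}

/-- Failure of accuracy being a measurable event, it suffices to bound its probability. -/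
lemma agnosticallyAccurate_of_far_le {N : ℕ} (M : Kernel (Fin N → X) (ProbabilityMeasure X))
    [IsMarkovKernel M]
    (h : ∀ g : ProbabilityMeasure X, outputLaw M g {f | C * distToClass g F + α < tvDist f g} ≤
      ENNReal.ofReal β) (hβ : 0 ≤ β) : AgnosticallyAccurate F C α β M := by
  intro g
  have hprob : IsProbabilityMeasure (outputLaw M g) := by
    unfold outputLaw
    infer_instance
  have hcompl : {f | C * distToClass g F + α < tvDist f g} =
      {f | tvDist f g ≤ C * distToClass g F + α}ᶜ := by
    ext f; simp
  have hg := h g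
  rw [hcompl, prob_compl_eq_one_sub (measurableSet_tvDist_le g _)] at hg
  rw [ENNReal.ofReal_sub _ hβ, ENNReal.ofReal_one]
  exact tsub_le_iff_tsub_le.mp hg

variable [Nonempty X]

omit [MeasurableSpace.CountablyGenerated X] in
/-- Empty lists contain nothing. -/
lemma StableListDecodable.length_pos {ρ : ℝ} (hρ : 0 < ρ)
    (h : StableListDecodable F C α m ρ L) : 0 < L := by
  obtain ⟨κ, -, hκ⟩ := h
  obtain ⟨x⟩ := ‹Nonempty X›
  obtain ⟨g', hg', -⟩ := hκ ⟨Measure.dirac x, inferInstance⟩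
  rcases Nat.eq_zero_or_pos L with rfl | hL
  · simp only [IsEmpty.exists_iff, Set.ofPred_false, measure_empty, nonpos_iff_eq_zero,
      ENNReal.ofReal_eq_zero] at hg'
    linarith
  · exact hL

/-- The error of the stable distribution, tripled, leaves room for the errors of the tests. -/
lemma three_mul_error_le {a d : ℝ} (hC : 1 < C) (hα : 0 < α) (hd : 0 ≤ d)
    (h : a < α / (3 + 4 * C) + C * d) : 3 * a + 4 * (α / 7) ≤ 7 * C * d + α := by
  have h1 : α / (3 + 4 * C) ≤ α / 7 := by gcongr; linarith
  have h2 : 0 ≤ C * d := mul_nonneg (by linarith) hd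
  linarith

/-- For lists of length one the stable distribution can be output without looking at the data. -/
lemma privatelyAgnosticLearnable_zero (hC : 1 < C) (hε : 0 < ε) (hα : 0 < α) (hβ : 0 < β)
    (h : StableListDecodable F C (α / (3 + 4 * C)) m 0.91 1) :
    PrivatelyAgnosticLearnable F ε δ (7 * C) 0 α β := by
  obtain ⟨κ, hκ, hstab⟩ := h
  choose G hG hGd using hstab
  obtain ⟨x⟩ := ‹Nonempty X›
  set f₁ := G ⟨Measure.dirac x, inferInstance⟩
  have hconst : ∀ g, G g = f₁ := fun g => stable_eq_of_singleton_lists κ hG _ _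
  refine ⟨fun N => Kernel.const _ (Measure.dirac f₁), fun N _ => ⟨inferInstance, ?_, ?_⟩⟩
  · intro D D' _ E _
    have h1 : (1 : ENNReal) ≤ ENNReal.ofReal (Real.exp ε) :=
      ENNReal.one_le_ofReal.mpr (Real.one_le_exp hε.le)
    simp only [Kernel.const_apply]
    exact ⟨(le_mul_of_one_le_left' h1).trans le_self_add,
      (le_mul_of_one_le_left' h1).trans le_self_add⟩
  · refine agnosticallyAccurate_of_far_le _ (fun g => ?_) hβ.le
    have hclose : tvDist f₁ g ≤ 7 * C * distToClass g F + α := by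
      have h0 := tvDist_nonneg (G g) g
      have := three_mul_error_le hC hα (distToClass_nonneg g F) (hGd g)
      rw [hconst g] at this h0
      linarith
    rw [outputLaw, Measure.const_comp]
    have hmeas : MeasurableSet {f | 7 * C * distToClass g F + α < tvDist f g} :=
      measurableSet_lt_tvDist g _
    simp [Measure.dirac_apply' _ hmeas, hclose]

lemma privatelyAgnosticLearnable_of_two_le (hL : 2 ≤ L) (hC : 1 < C) (hε : 0 < ε) (hδ : 0 < δ)
    (hδ1 : δ < 1) (hα : 0 < α) (hβ : 0 < β) (hβ1 : β < 1)
    (h : StableListDecodable F C (α / (3 + 4 * C)) m 0.91 L) :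
    PrivatelyAgnosticLearnable F ε δ (7 * C)
      (10 * blockParam ε δ β L * (m + testSize ε δ α β L)) α β := by
  classical
  obtain ⟨κ, hκ, hstab⟩ := h
  obtain ⟨A, hA⟩ := exists_isDetermining X
  obtain ⟨x⟩ := ‹Nonempty X›
  set f₀ : ProbabilityMeasure X := ⟨Measure.dirac x, inferInstance⟩
  have hL' : (2 : ℝ) ≤ L := by exact_mod_cast hL
  have h3 : 0 < min ε 1 := lt_min hε one_pos
  have hη : 0 < α / 7 := by positivity
  have hε' : 0 ≤ min ε 1 / 2 := by positivity
  have hW1 : 1 ≤ 8 * L / δ := (one_le_div hδ).mpr (by linarith)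
  have hW : 0 < 8 * L / δ := by linarith
  have hτ := blockParam_pos hL hε hδ hδ1 hβ hβ1
  have hs := testSize_pos hL hε hδ hδ1 hα hβ hβ1
  obtain ⟨hf1, hf2, hf3⟩ := failure_bounds hL hε hδ hδ1 hα hβ hβ1 rfl rfl
  set τ := blockParam ε δ β L
  set s := testSize ε δ α β L
  have hN : ∀ N, 10 * τ * (m + s) ≤ N → ∃ M : Kernel (Fin N → X) (ProbabilityMeasure X),
      IsMarkovKernel M ∧ DifferentiallyPrivate ε δ M ∧ AgnosticallyAccurate F (7 * C) α β M := by
    intro N hN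
    obtain ⟨e⟩ : Nonempty ((Fin (10 * τ) × Fin m) ⊕ (Fin (10 * τ) × Fin s) ↪ Fin N) := by
      refine Function.Embedding.nonempty_of_card_le ?_
      simpa [mul_add] using hN
    refine ⟨learner hA.1 hη hε' hW f₀ κ e, inferInstance, ?_, ?_⟩
    · refine differentiallyPrivate_learner hA.1 hη hε' hW f₀ κ hτ e.injective ?_ ?_
      · linarith [min_le_left ε 1]
      · have hexp : Real.exp (2 * (min ε 1 / 2)) ≤ 3 := by
          calc Real.exp (2 * (min ε 1 / 2)) ≤ Real.exp 1 :=
                Real.exp_le_exp.mpr (by linarith [min_le_right ε 1])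
            _ ≤ 3 := by linarith [Real.exp_one_lt_d9]
        rw [div_le_iff₀ hW]
        push_cast
        have : δ * (8 * L / δ) = 8 * L := by field_simp
        nlinarith
    · refine agnosticallyAccurate_of_far_le _ (fun g => ?_) hβ.le
      obtain ⟨f₁, hf₁, hd⟩ := hstab g
      have hE : MeasurableSet {f | 7 * C * distToClass g F + α < tvDist f g} :=
        measurableSet_lt_tvDist g _
      refine (outputLaw_learner_far_le hη hε' hW f₀ κ hA hW1 hτ hs e.injective hf₁ le_rfl hE
        fun f hf => lt_of_le_of_lt
          (three_mul_error_le hC hα (distToClass_nonneg g F) hd) hf).trans ?_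
      calc _ ≤ ENNReal.ofReal (β / 3) + ENNReal.ofReal (β / 3) + ENNReal.ofReal (β / 3) := by
            gcongr
        _ = ENNReal.ofReal β := by
            rw [← ENNReal.ofReal_add (by positivity) (by positivity),
              ← ENNReal.ofReal_add (by positivity) (by positivity)]
            congr 1
            ring
  choose M hM using hN
  refine ⟨fun N => if h : 10 * τ * (m + s) ≤ N then M N h else 0, fun N hN => ?_⟩
  simp only [dif_pos hN]
  exact hM N hN

end Conclusion

end PrivateDensity


theorem mainTheorem1 :
    ∃ K : ℝ, 0 < K ∧ ∃ k : ℕ,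
      ∀ (X : Type*) [MeasurableSpace X] [MeasurableSpace.CountablyGenerated X] [Nonempty X]
        (F : Set (ProbabilityMeasure X)), F.Nonempty →
      ∀ (m L : ℕ) (C ε δ α β : ℝ), 1 < C → 0 < ε → 0 < δ → δ < 1 → 0 < α → α < 1 → 0 < β → β < 1 →
        PrivateDensity.StableListDecodable F C (α / (3 + 4 * C)) m 0.91 L →
        ∃ n : ℕ,
          (n : ℝ) ≤ K * PrivateDensity.sampleRate ε δ α β m L *
              Real.log (2 + PrivateDensity.sampleRate ε δ α β m L) ^ k ∧
            PrivateDensity.PrivatelyAgnosticLearnable F ε δ (7 * C) n α β := by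
  refine ⟨64000, by norm_num, 1, ?_⟩
  intro X _ _ _ F _ m L C ε δ α β hC hε hδ hδ1 hα hα1 hβ hβ1 h
  have hL : 0 < L := h.length_pos (by norm_num)
  rcases Nat.lt_or_ge L 2 with hL2 | hL2
  · obtain rfl : L = 1 := by omega
    refine ⟨0, ?_, PrivateDensity.privatelyAgnosticLearnable_zero hC hε hα hβ h⟩
    have hΦ := PrivateDensity.sampleRate_nonneg (α := α) (m := m) le_rfl hε hδ hδ1 hβ hβ1
    have hlog : 0 ≤ Real.log (2 + PrivateDensity.sampleRate ε δ α β m 1) :=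
      Real.log_nonneg (by linarith)
    push_cast
    positivity
  · refine ⟨_, ?_, PrivateDensity.privatelyAgnosticLearnable_of_two_le hL2 hC hε hδ hδ1 hα hβ hβ1 h⟩
    rw [pow_one]
    exact PrivateDensity.sampleSize_le hL2 hε hδ hδ1 hα hα1 hβ hβ1
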